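/- Let $\overline{\mathbb{Q}}$ be the field of algebraic numbers, $\mathcal{G}=\overline{\mathbb{Q}}^{\times}/\mathrm{Tor}(\overline{\mathbb{Q}}^{\times})$, and $Y$ the set of places $y$ of $\overline{\mathbb{Q}}$. For a place $v$ of a number field $k$ let $\|\cdot\|_v$ be the absolute value in $v$ that restricts to the usual real or $p$-adic absolute value on $\mathbb{Q}$, let $[k_v:\mathbb{Q}_v]$ be the local degree, and define $\|\cdot\|_y$ for $y\in Y$ in the same way. For $k\subseteq\overline{\mathbb{Q}}$ put $Y(k,v)=\{y\in Y: y\mid v\}$. Give $Y$ the topology generated by the sets $Y(l,w)$ with $l/\mathbb{Q}$ finite Galois and $w$ a place of $l$, and let $\lambda$ be the unique regular Borel measure on $Y$ that is invariant under $\mathrm{Aut}(\overline{\mathbb{Q}}/\mathbb{Q})$ and satisfies $\lambda(Y(l,w))=[l_w:\mathbb{Q}_w]/[l:\mathbb{Q}]$ for all such $l$ and $w$. For $\alpha\in\mathcal{G}$ let $f_\alpha(y)=\log\|\alpha\|_y$. The height of a finitely generated subgroup $\mathfrak{A}\subseteq\mathcal{G}$ with $\mathbb{Z}$-basis $\alpha_1,\dots,\alpha_N$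 is $$h(\mathfrak{A})=2^{-N}\int_{Y^N}\bigl|\det\bigl(f_{\alpha_l}(y_n)\bigr)_{l,n}\bigr|\,d\lambda^N(y_1,\dots,y_N),$$ which does not depend on the basis. Let $k\subseteq\overline{\mathbb{Q}}$ be a number field and $S$ a finite set of places of $k$ that contains all archimedean places, with $|S|=s\ge 2$. Let $U_S(k)=\{\gamma\in k^{\times}:\|\gamma\|_v=1\text{ for all }v\notin S\}$, and let $\mathfrak{U}_S(k)$ be its image in $\mathcal{G}$. Let $\mathrm{Reg}_S(k)=\bigl|\det\bigl([k_v:\mathbb{Q}_v]\log\|\eta_l\|_v\bigr)\bigr|$ be the $S$-regulator, where $\eta_1,\dots,\eta_{s-1}$ is a fundamental system of $S$-units (a $\mathbb{Z}$-basis of $U_S(k)$ modulo torsion) and $v$ runs through all but one of the places in $S$. Then $\mathfrak{U}_S(k)$ is finitely generated of rank $s-1$, and $$h\bigl(\mathfrak{U}_S(k)\bigr)=\frac{s!\,\mathrm{Reg}_S(k)}{\bigl(2[k:\mathbb{Q}]\bigr)^{s-1}}.$$ -/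

import Mathlib

open MeasureTheory
open scoped ENNReal Nat

/-- The field of algebraic numbers. -/
abbrev Qbar : Type := AlgebraicClosure ℚ

/-- A place of an algebraic extension `K` of `ℚ`, given by its normalized absolute value `‖·‖_v`:
the representative of the equivalence class which restricts on `ℚ` to the usual real absolute
value or to the usual `p`-adic absolute value for a prime `p`.  (By Ostrowski's theorem every
equivalence class of nontrivial absolute values contains exactly one such absolute value.) -/
@[ext]
structure Place (K : Type*) [Field K] [CharZero K] where
  /-- The normalized absolute value `‖·‖_v`. -/
  abv : AbsoluteValue K ℝ
  normalized : (∀ q : ℚ, abv (q : K) = Rat.AbsoluteValue.real q) ∨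
    ∃ (p : ℕ) (_ : Fact p.Prime), ∀ q : ℚ, abv (q : K) = Rat.AbsoluteValue.padic p q

namespace Place

/-- `v ∣ ∞`: the place is archimedean. -/
def IsArchimedean {K : Type*} [Field K] [CharZero K] (v : Place K) : Prop :=
  ∀ q : ℚ, v.abv (q : K) = Rat.AbsoluteValue.real q

/-- The place of `K` lying below a place `w` of `L`. -/
def restrict (K : Type*) {L : Type*} [Field K] [CharZero K] [Field L] [CharZero L] [Algebra K L]
    (w : Place L) : Place K where
  abv := w.abv.comp (algebraMap K L).injective
  normalized := by
    have h : ∀ q : ℚ, w.abv.comp (algebraMap K L).injective (q : K) = w.abv (q : L) := fun q =>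
      congrArg w.abv (map_ratCast (algebraMap K L) q)
    simpa only [h] using w.normalized

/-- The local degree `[K_v : ℚ_v]`, where `K_v` is the completion of `K` at `v` and `ℚ_v` is the
closure of the prime field `ℚ` in `K_v`. -/
noncomputable def localDegree {K : Type*} [Field K] [CharZero K] (v : Place K) : ℕ :=
  Module.finrank (⊥ : Subfield v.abv.Completion).topologicalClosure v.abv.Completion

/-- `Y(K, v)`: the set of places of the field of algebraic numbers lying over `v`. -/
def fiber {K : Type*} [Field K] [CharZero K] [Algebra K Qbar] (v : Place K) : Set (Place Qbar) :=
  {y | y.restrict K = v}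

/-- The topology on the space `Y` of all places of the field of algebraic numbers, generated by
the sets `Y(l, w)` where `l` is a finite Galois extension of `ℚ` and `w` is a place of `l`. -/
instance : TopologicalSpace (Place Qbar) :=
  TopologicalSpace.generateFrom
    {E | ∃ l : IntermediateField ℚ Qbar, FiniteDimensional ℚ l ∧ IsGalois ℚ l ∧
      ∃ w : Place l, E = w.fiber}

/-- The Borel `σ`-algebra of `Y`. -/
instance : MeasurableSpace (Place Qbar) := borel (Place Qbar)

instance : BorelSpace (Place Qbar) := ⟨rfl⟩

/-- The action of the absolute Galois group on `Y`: `‖α‖_{τ y} = ‖τ⁻¹ α‖_y`. -/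
noncomputable def galois (τ : Qbar ≃ₐ[ℚ] Qbar) (y : Place Qbar) : Place Qbar where
  abv := y.abv.comp (f := (τ.symm : Qbar →+* Qbar)) τ.symm.injective
  normalized := by
    have h : ∀ q : ℚ, y.abv.comp (f := (τ.symm : Qbar →+* Qbar)) τ.symm.injective (q : Qbar) =
        y.abv (q : Qbar) := fun q =>
      congrArg y.abv (map_ratCast (τ.symm : Qbar →+* Qbar) q)
    simpa only [h] using y.normalized

end Place

/-- The property that characterizes the normalized invariant measure `λ` on the Borel subsets of
`Y`: it is regular, it is invariant under the absolute Galois group, and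
`λ(Y(l, w)) = [l_w : ℚ_w] / [l : ℚ]` for every finite Galois extension `l / ℚ` and every place `w`
of `l`. -/
structure IsNormalizedInvariant (μ : Measure (Place Qbar)) : Prop where
  regular : μ.Regular
  invariant : ∀ (τ : Qbar ≃ₐ[ℚ] Qbar) (E : Set (Place Qbar)), MeasurableSet E →
    μ (Place.galois τ '' E) = μ E
  fiber : ∀ l : IntermediateField ℚ Qbar, FiniteDimensional ℚ l → IsGalois ℚ l →
    ∀ w : Place l, μ w.fiber = (w.localDegree : ℝ≥0∞) / (Module.finrank ℚ l : ℝ≥0∞)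

/-- The measure `λ`: the unique regular Borel measure on `Y` which is Galois invariant and
satisfies `λ(Y(l, w)) = [l_w : ℚ_w] / [l : ℚ]` for all finite Galois extensions `l / ℚ`. -/
noncomputable def placeMeasure : Measure (Place Qbar) :=
  Classical.epsilon IsNormalizedInvariant

/-- The multiplicative group `𝒢` of nonzero algebraic numbers modulo torsion. -/
abbrev GroupG : Type := Qbarˣ ⧸ CommGroup.torsion Qbarˣ

/-- A root of unity has absolute value one. -/
lemma abv_eq_one_of_isOfFinOrder {K : Type*} [Field K] (v : AbsoluteValue K ℝ) {u : Kˣ}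
    (hu : IsOfFinOrder u) : v (u : K) = 1 := by
  obtain ⟨n, hn, h⟩ := isOfFinOrder_iff_pow_eq_one.1 hu
  have h1 : v (u : K) ^ n = 1 := by
    rw [← map_pow, ← Units.val_pow_eq_pow_val, h, Units.val_one, map_one]
  exact (pow_eq_one_iff_of_nonneg (v.nonneg _) hn.ne').1 h1

/-- The homomorphism `u ↦ log ‖u‖_v`, written multiplicatively. -/
noncomputable def logAbv {K : Type*} [Field K] (v : AbsoluteValue K ℝ) :
    Kˣ →* Multiplicative ℝ where
  toFun u := Multiplicative.ofAdd (Real.log (v (u : K)))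
  map_one' := by simp
  map_mul' a b := by
    rw [Units.val_mul, map_mul,
      Real.log_mul (v.ne_zero a.ne_zero) (v.ne_zero b.ne_zero), ofAdd_add]

/-- The function `f_α(y) = log ‖α‖_y` on `Y` attached to a point `α` of `𝒢`. -/
noncomputable def logFun (α : GroupG) (y : Place Qbar) : ℝ :=
  (QuotientGroup.lift (CommGroup.torsion Qbarˣ) (logAbv y.abv) (fun u hu => by
    have h := abv_eq_one_of_isOfFinOrder y.abv (K := Qbar) (u := u) hu
    simp [MonoidHom.mem_ker, logAbv, h]) α).toAdd

/-- `Δ(F₁, …, F_N; x) = det (F_l(x_n))`. -/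
noncomputable def deltaDet {X : Type*} {N : ℕ} (F : Fin N → X → ℝ) (x : Fin N → X) : ℝ :=
  (Matrix.of fun l n : Fin N => F l (x n)).det

open Classical in
/-- The height of a finitely generated subgroup `A` of `𝒢` of rank `N`:
`h(A) = 2⁻ᴺ ∫_{Yᴺ} |Δ(f_{α₁}, …, f_{α_N}; y)| dλᴺ(y)`, where `α₁, …, α_N` is a basis of the
`ℤ`-module `A`; the value does not depend on the basis.  (The value for subgroups without a finite
basis is irrelevant.) -/
noncomputable def height (A : Subgroup GroupG) : ℝ :=
  if h : Nonempty (Module.Basis (Fin (Module.finrank ℤ (Additive A))) ℤ (Additive A)) then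
    (2 ^ Module.finrank ℤ (Additive A))⁻¹ *
      ∫ y : Fin (Module.finrank ℤ (Additive A)) → Place Qbar,
        |deltaDet (fun l => logFun ((h.some l).toMul : GroupG)) y|
          ∂(Measure.pi fun _ => placeMeasure)
  else 0

section SUnits

/-- The group `U_S(k)` of `S`-units. -/
def sUnits {k : Type*} [Field k] [CharZero k] (S : Finset (Place k)) : Subgroup kˣ where
  carrier := {γ | ∀ v : Place k, v ∉ S → v.abv (γ : k) = 1}
  one_mem' := fun v _ => by simp
  mul_mem' := fun {a b} ha hb v hv => by
    rw [Units.val_mul, map_mul, ha v hv, hb v hv, mul_one]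
  inv_mem' := fun {a} ha v hv => by
    rw [Units.val_inv_eq_inv_val, map_inv₀, ha v hv, inv_one]

/-- The image `𝔘_S(k)` of `U_S(k)` in `𝒢`. -/
noncomputable def sUnitsImage {k : Type*} [Field k] [CharZero k] [Algebra k Qbar]
    (S : Finset (Place k)) : Subgroup GroupG :=
  (sUnits S).map
    ((QuotientGroup.mk' (CommGroup.torsion Qbarˣ)).comp
      (Units.map (algebraMap k Qbar : k →* Qbar)))

/-- A family of `S`-units is a fundamental system if its image in the quotient of `U_S(k)` by its
torsion subgroup is a `ℤ`-basis. -/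
def IsFundamentalSystem {k : Type*} [Field k] [CharZero k] (S : Finset (Place k)) {ι : Type*}
    (η : ι → sUnits S) : Prop :=
  ∃ b : Module.Basis ι ℤ (Additive (sUnits S ⧸ CommGroup.torsion (sUnits S))),
    ∀ i, b i = Additive.ofMul (QuotientGroup.mk (η i))

/-- The choices that enter the definition of the `S`-regulator: a place `v₀ ∈ S` to be left out,
and a fundamental system of `S`-units, indexed by the remaining places of `S`. -/
structure RegulatorData {k : Type*} [Field k] [CharZero k] (S : Finset (Place k)) where
  /-- The place that is left out. -/
  v₀ : Place k
  mem : v₀ ∈ S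
  /-- The fundamental system. -/
  η : {v : Place k // v ∈ S ∧ v ≠ v₀} → sUnits S
  fundamental : IsFundamentalSystem S η

open Classical in
/-- The `S`-regulator `Reg_S(k) = |det ([k_v : ℚ_v] log ‖η_l‖_v)|`, where `(η_l)` is a fundamental
system of `S`-units and `v` runs through all places in `S` but one; the value does not depend on
the choices. -/
noncomputable def sRegulator {k : Type*} [Field k] [CharZero k] (S : Finset (Place k)) : ℝ :=
  if h : Nonempty (RegulatorData S) then
    haveI : Fintype {v : Place k // v ∈ S ∧ v ≠ h.some.v₀} :=
      Fintype.ofFinset (S.erase h.some.v₀) (fun v => by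
        rw [Finset.mem_erase, and_comm]; rfl)
    |(Matrix.of fun l v : {v : Place k // v ∈ S ∧ v ≠ h.some.v₀} =>
      (v.1.localDegree : ℝ) * Real.log (v.1.abv ((h.some.η l : kˣ) : k))).det|
  else 0

end SUnits

section

/-! Let N = s - 1 and let u_1, ..., u_N be S-units giving a basis modulo torsion. The integrand at
(y_1, ..., y_N) depends only on the restrictions of the y_n to k, and it vanishes as soon as one of
them lies outside S. The integral is therefore a finite sum over maps c from {1, ..., N} to S, with
weights the products of the λ(Y(k, c_n)) = [k_v : ℚ_v] / [k : ℚ], v = c_n (`integral_abs_det_log`).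
Moving the local degrees into the columns turns it into [k : ℚ]^(-N) times the sum of |minors| of
the N × (N + 1) matrix ([k_v : ℚ_v] log ‖u_l‖_v). By the product formula its rows sum to zero, so
all maximal minors have the same absolute value, the regulator. Non-injective c contribute 0, and
there are (N + 1)! = s! injective ones (`sum_abs_det_submatrix`).

Three inputs support this. The measure λ exists: it is the sum over the places q of ℚ of the images
of Haar measure on the Galois group under an orbit map, and it takes the required values because the
local degree at v counts the embeddings of k in `Qbar` that induce v from a fixed place
(`natCard_comap_eq_localDegree`). The same count yields the product formula by grouping the
conjugates in a norm. The rank of the S-units follows from Dirichlet's unit theorem and the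
finiteness of the class group (`finrank_sUnits`). -/

instance : Algebra.IsAlgebraic ℚ Qbar := AlgebraicClosure.isAlgebraic ℚ

/-! ### Normalized places and the places of ℚ below them. -/

namespace Place

variable {K L M : Type*} [Field K] [CharZero K] [Field L] [CharZero L] [Field M] [CharZero M]

/-- The pullback of a place along a field embedding. -/
def comap (σ : K →+* L) (w : Place L) : Place K where
  abv := w.abv.comp σ.injective
  normalized := by
    have h : ∀ q : ℚ, w.abv.comp σ.injective (q : K) = w.abv (q : L) := fun q =>
      congrArg w.abv (map_ratCast σ q)
    simpa only [h] using w.normalized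

@[simp] lemma comap_abv_apply (σ : K →+* L) (w : Place L) (x : K) :
    (comap σ w).abv x = w.abv (σ x) := rfl

lemma comap_comap (σ : K →+* L) (τ : L →+* M) (w : Place M) :
    comap σ (comap τ w) = comap (τ.comp σ) w := rfl

lemma restrict_eq_comap [Algebra K L] (w : Place L) :
    w.restrict K = comap (algebraMap K L) w := rfl

lemma ext_abv {v w : Place K} (h : ∀ x, v.abv x = w.abv x) : v = w :=
  Place.ext (AbsoluteValue.ext h)

/-- The normalized absolute values of `ℚ`, indexed by the primes and `∞`. -/
noncomputable def ratAbv : Option Nat.Primes → AbsoluteValue ℚ ℝ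
  | none => Rat.AbsoluteValue.real
  | some p => haveI : Fact p.1.Prime := ⟨p.2⟩; Rat.AbsoluteValue.padic p.1

/-- The place `v` lies over the place `q` of `ℚ`. -/
def Over (v : Place K) (q : Option Nat.Primes) : Prop :=
  ∀ x : ℚ, v.abv (x : K) = ratAbv q x

lemma exists_over (v : Place K) : ∃ q, v.Over q := by
  rcases v.normalized with h | ⟨p, hp, h⟩
  · exact ⟨none, h⟩
  · exact ⟨some ⟨p, hp.1⟩, h⟩

lemma Over.comap {w : Place L} {q : Option Nat.Primes} (h : w.Over q) (σ : K →+* L) :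
    (comap σ w).Over q := fun x => by
  rw [comap_abv_apply, map_ratCast, h]

@[simp] lemma over_comap_iff {w : Place L} {q : Option Nat.Primes} (σ : K →+* L) :
    (comap σ w).Over q ↔ w.Over q := by
  refine ⟨fun h x => ?_, fun h => h.comap σ⟩
  rw [← h x, comap_abv_apply, map_ratCast σ]

lemma ratAbv_prime_self (p : Nat.Primes) : ratAbv (some p) (p.1 : ℚ) = (p.1 : ℝ)⁻¹ := by
  have : Fact p.1.Prime := ⟨p.2⟩
  simp [ratAbv, Rat.AbsoluteValue.padic_eq_padicNorm]

lemma ratAbv_prime_ne {p q : Nat.Primes} (h : p ≠ q) : ratAbv (some p) (q.1 : ℚ) = 1 := by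
  have : Fact p.1.Prime := ⟨p.2⟩
  have : Fact q.1.Prime := ⟨q.2⟩
  have h' : p.1 ≠ q.1 := fun e => h (Subtype.ext e)
  simp [ratAbv, Rat.AbsoluteValue.padic_eq_padicNorm, padicNorm.padicNorm_of_prime_of_ne h']

lemma ratAbv_some_natCast_le_one (p : Nat.Primes) (n : ℕ) : ratAbv (some p) (n : ℚ) ≤ 1 := by
  have : Fact p.1.Prime := ⟨p.2⟩
  exact_mod_cast Rat.AbsoluteValue.padic_le_one p.1 n

lemma ratAbv_injective : Function.Injective ratAbv := by
  rintro (_ | p) (_ | q) h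
  · rfl
  · have := ratAbv_some_natCast_le_one q 2
    rw [← h] at this
    norm_num [ratAbv] at this
  · have := ratAbv_some_natCast_le_one p 2
    rw [h] at this
    norm_num [ratAbv] at this
  · by_contra hpq
    have h1 := ratAbv_prime_self q
    rw [← h, ratAbv_prime_ne fun e => hpq (by rw [e])] at h1
    have : (1 : ℝ) < q.1 := by exact_mod_cast q.2.one_lt
    exact (inv_lt_one_of_one_lt₀ this).ne h1.symm

lemma Over.unique {v : Place K} {q r : Option Nat.Primes} (h : v.Over q) (h' : v.Over r) :
    q = r := ratAbv_injective (AbsoluteValue.ext fun x => by rw [← h x, h' x])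

/-- A rational number whose absolute value at `q` is neither `0` nor `1`. -/
lemma exists_ratAbv_lt_one (q : Option Nat.Primes) :
    ∃ a : ℚ, 0 < ratAbv q a ∧ ratAbv q a < 1 := by
  rcases q with _ | p
  · exact ⟨1 / 2, by norm_num [ratAbv], by norm_num [ratAbv, abs_lt]⟩
  · have : (1 : ℝ) < p.1 := by exact_mod_cast p.2.one_lt
    refine ⟨p.1, ?_, ?_⟩ <;> rw [ratAbv_prime_self]
    · positivity
    · exact inv_lt_one_of_one_lt₀ this

lemma exists_abv_lt_one (v : Place K) : ∃ a : ℚ, 0 < v.abv (a : K) ∧ v.abv (a : K) < 1 := by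
  obtain ⟨q, hq⟩ := v.exists_over
  obtain ⟨a, h0, h1⟩ := exists_ratAbv_lt_one q
  exact ⟨a, by rwa [hq], by rwa [hq]⟩

lemma isNontrivial (v : Place K) : v.abv.IsNontrivial := by
  obtain ⟨a, h0, h1⟩ := v.exists_abv_lt_one
  exact ⟨a, fun h => by simp [h] at h0, h1.ne⟩

/-- Equivalent normalized absolute values over the same place of `ℚ` are equal. -/
lemma eq_of_isEquiv {v w : Place K} {q : Option Nat.Primes} (hv : v.Over q) (hw : w.Over q)
    (h : v.abv.IsEquiv w.abv) : v = w := by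
  obtain ⟨c, hc, hcw⟩ := AbsoluteValue.isEquiv_iff_exists_rpow_eq.1 h
  obtain ⟨a, h0, h1⟩ := exists_ratAbv_lt_one q
  have h2 := congrFun hcw (a : K)
  simp only [hv a, hw a] at h2
  -- Equivalent absolute values differ by an exponent c. Both agree at a, where the value lies
  -- strictly between 0 and 1.
  have hc1 : c = 1 := by
    have h3 : ratAbv q a ^ c = ratAbv q a ^ (1 : ℝ) := by rw [h2, Real.rpow_one]
    exact (Real.rpow_right_inj h0 h1.ne).1 h3
  refine ext_abv fun x => ?_
  have := congrFun hcw x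
  simpa [hc1] using this

lemma eq_of_lt_one_imp {v w : Place K} {q : Option Nat.Primes} (hv : v.Over q) (hw : w.Over q)
    (h : ∀ x, v.abv x < 1 → w.abv x < 1) : v = w :=
  eq_of_isEquiv hv hw (AbsoluteValue.isEquiv_of_lt_one_imp v.isNontrivial h)

/-- A place over a prime is non-archimedean. -/
lemma Over.add_le_max {v : Place K} {p : Nat.Primes} (hv : v.Over (some p)) (x y : K) :
    v.abv (x + y) ≤ max (v.abv x) (v.abv y) := by
  let _ : NormedField K := v.abv.toNormedField
  have h : IsNonarchimedean (norm : K → ℝ) := by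
    have := (isUltrametricDist_iff_forall_norm_natCast_le_one (R := K)).2 fun n => by
      have := ratAbv_some_natCast_le_one p n
      rw [← hv, Rat.cast_natCast] at this
      exact this
    exact IsUltrametricDist.isNonarchimedean_norm
  exact h x y

/-- The place of a field defined by an embedding into a normed field. -/
noncomputable def ofNormed {E : Type*} [NormedField E] (σ : K →+* E)
    (h : (∀ q : ℚ, ‖(q : E)‖ = Rat.AbsoluteValue.real q) ∨
      ∃ (p : ℕ) (_ : Fact p.Prime), ∀ q : ℚ, ‖(q : E)‖ = Rat.AbsoluteValue.padic p q) :
    Place K where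
  abv := (NormedField.toAbsoluteValue E).comp σ.injective
  normalized := by
    have h1 : ∀ q : ℚ, (NormedField.toAbsoluteValue E).comp σ.injective (q : K) = ‖(q : E)‖ :=
      fun q => congrArg norm (map_ratCast σ q)
    simpa only [h1] using h

/-- The place of `Qbar` defined by an embedding into the complex numbers. -/
lemma exists_over_none (σ : Qbar →+* ℂ) : ∃ y : Place Qbar, y.Over none ∧ ∀ x, y.abv x = ‖σ x‖ :=
  have h : ∀ q : ℚ, ‖(q : ℂ)‖ = Rat.AbsoluteValue.real q := fun q => by simp
  ⟨ofNormed σ (Or.inl h), fun q => (congrArg norm (map_ratCast σ q)).trans (h q), fun _ => rfl⟩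

lemma exists_over_Qbar (q : Option Nat.Primes) : ∃ y : Place Qbar, y.Over q := by
  rcases q with _ | p
  · exact (exists_over_none (IsAlgClosed.lift (R := ℚ) (S := Qbar) (M := ℂ)).toRingHom).imp
      fun _ h => h.1
  · have : Fact p.1.Prime := ⟨p.2⟩
    let σ : Qbar →+* PadicAlgCl p.1 :=
      (IsAlgClosed.lift (R := ℚ) (S := Qbar) (M := PadicAlgCl p.1)).toRingHom
    have h : ∀ q : ℚ, ‖(q : PadicAlgCl p.1)‖ = Rat.AbsoluteValue.padic p.1 q := fun q => by
      have h1 := PadicAlgCl.norm_extends p.1 (q : ℚ_[p.1])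
      rw [map_ratCast] at h1
      rw [h1, Padic.eq_padicNorm, Rat.AbsoluteValue.padic_eq_padicNorm]
    exact ⟨ofNormed σ (Or.inr ⟨p.1, inferInstance, h⟩), fun q =>
      (congrArg norm (map_ratCast σ q)).trans (h q)⟩

end Place

end

/-! ### Places of a number field come from embeddings in the algebraic numbers. -/

section

namespace Place

open Polynomial

variable {L : Type*} [Field L] [NumberField L]

/-- Every conjugate of `x` is its image under an extension of `f`. -/
lemma exists_ringHom_of_mem_roots (f : ℚ →+* Qbar) (x : L) {z : Qbar}
    (hz : z ∈ ((minpoly ℚ x).map f).roots) : ∃ σ : L →+* Qbar, σ x = z := by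
  have hf : f = algebraMap ℚ Qbar := Subsingleton.elim _ _
  subst hf
  have hx : IsIntegral ℚ x := Algebra.IsIntegral.isIntegral x
  have hz' : z ∈ (minpoly ℚ x).aroots Qbar := hz
  rw [mem_aroots] at hz'
  have hzr : z ∈ (minpoly ℚ x).rootSet Qbar := by
    rw [mem_rootSet]
    exact ⟨hz'.1, hz'.2⟩
  rw [← Algebra.IsAlgebraic.range_eval_eq_rootSet_minpoly (F := ℚ) Qbar x] at hzr
  obtain ⟨g, hg⟩ := hzr
  exact ⟨g.toRingHom, hg⟩

/-- The coefficients of the minimal polynomial are symmetric functions of the conjugates, so b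
bounds them at y; being rational, they have the same absolute value at v. Solving the equation for
x^d gives X^d ≤ (X + b)^d - X^d with X = `v.abv x`. For small b this conflicts with X ≥ 1. -/
lemma two_mul_pow_le_of_conj_le {v : Place L} {y : Place Qbar} {q : Option Nat.Primes}
    (hv : v.Over q) (hy : y.Over q) (x : L) {b : ℝ}
    (hb : ∀ σ : L →+* Qbar, y.abv (σ x) ≤ b) :
    2 * v.abv x ^ (minpoly ℚ x).natDegree ≤ (v.abv x + b) ^ (minpoly ℚ x).natDegree := by
  set P := minpoly ℚ x
  set d := P.natDegree
  have hP : P.Monic := minpoly.monic (Algebra.IsIntegral.isIntegral x)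
  let f : ℚ →+* WithAbs y.abv := (WithAbs.equiv y.abv).symm.toRingHom.comp (algebraMap ℚ Qbar)
  have hspl : (P.map f).Splits := by
    rw [← Polynomial.map_map]
    exact (IsAlgClosed.splits _).map _
  have hroots : ∀ z ∈ (P.map f).roots, ‖z‖ ≤ b := by
    intro z hz
    rw [← Polynomial.map_map] at hz
    rw [(IsAlgClosed.splits (P.map (algebraMap ℚ Qbar))).roots_map, Multiset.mem_map] at hz
    obtain ⟨z, h1, rfl⟩ := hz
    obtain ⟨σ, hσ⟩ := exists_ringHom_of_mem_roots _ x h1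
    have := hb σ
    rw [hσ] at this
    exact this
  have hcoeff : ∀ i, v.abv ((P.coeff i : ℚ) : L) ≤ b ^ (d - i) * d.choose i := by
    intro i
    have := coeff_le_of_roots_le i hP hspl hroots
    rw [coeff_map] at this
    refine le_trans (le_of_eq ?_) this
    rw [hv, ← hy]
    exact congrArg y.abv (eq_ratCast (algebraMap ℚ Qbar) _).symm
  have hzero : x ^ d = - ∑ i ∈ Finset.range d, ((P.coeff i : ℚ) : L) * x ^ i := by
    have h0 : aeval x P = 0 := minpoly.aeval ℚ x
    rw [aeval_eq_sum_range, Finset.sum_range_succ] at h0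
    have : P.coeff d = 1 := hP
    rw [show P.natDegree = d from rfl, this, one_smul] at h0
    rw [eq_neg_iff_add_eq_zero, add_comm, ← h0]
    simp [Rat.smul_def]
  have hle : v.abv x ^ d ≤
      ∑ i ∈ Finset.range d, v.abv x ^ i * b ^ (d - i) * d.choose i := by
    rw [← map_pow, hzero, AbsoluteValue.map_neg]
    refine (v.abv.sum_le _ _).trans (Finset.sum_le_sum fun i _ => ?_)
    rw [map_mul, map_pow, mul_comm, mul_assoc]
    exact mul_le_mul_of_nonneg_left (hcoeff i) (by positivity)
  rw [add_pow, Finset.sum_range_succ, two_mul]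
  simpa using hle

open Classical in
/-- Every place of a number field over `q` is induced by an embedding into `Qbar` from any given
place of `Qbar` over `q`. -/
theorem exists_comap_eq {v : Place L} {y : Place Qbar} {q : Option Nat.Primes}
    (hv : v.Over q) (hy : y.Over q) : ∃ σ : L →+* Qbar, comap σ y = v := by
  by_contra! hne
  let T : Set (Place L) := insert v (Set.range fun σ : L →+* Qbar => comap σ y)
  have hT : ∀ w ∈ T, w.Over q := by
    rintro w (rfl | ⟨σ, rfl⟩)
    exacts [hv, hy.comap σ]
  have : Finite T := (Set.finite_range _).insert v
  -- Weak approximation: if no embedding induced v, some x would be large at v while all its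
  -- conjugates are small at y. A high power of x then contradicts `two_mul_pow_le_of_conj_le`.
  obtain ⟨x, hx1, hx2⟩ := AbsoluteValue.exists_one_lt_lt_one_pi_of_not_isEquiv
    (v := fun w : T => w.1.abv) (fun w => w.1.isNontrivial)
    (fun w w' hww h => hww (Subtype.ext (eq_of_isEquiv (hT _ w.2) (hT _ w'.2) h)))
    ⟨v, Set.mem_insert _ _⟩
  have hx2' : ∀ σ : L →+* Qbar, y.abv (σ x) < 1 := fun σ =>
    hx2 ⟨comap σ y, Set.mem_insert_of_mem _ ⟨σ, rfl⟩⟩ fun h => hne σ (congrArg Subtype.val h)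
  simp only at hx1
  set n := Module.finrank ℚ L
  -- The degree of x^m may vary with m but is at most n, so b is fixed before m.
  obtain ⟨b, hb0, hb⟩ : ∃ b : ℝ, 0 < b ∧ (1 + b) ^ n < 2 := by
    have hc : Filter.Tendsto (fun b : ℝ => (1 + b) ^ n) (nhdsWithin 0 (Set.Ioi 0)) (nhds 1) := by
      have : Continuous fun b : ℝ => (1 + b) ^ n := by fun_prop
      simpa using (this.tendsto 0).mono_left nhdsWithin_le_nhds
    obtain ⟨b, h1, h2⟩ := ((hc.eventually (gt_mem_nhds one_lt_two)).and
      self_mem_nhdsWithin).exists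
    exact ⟨b, h2, h1⟩
  have hev : ∀ σ : L →+* Qbar, ∀ᶠ m : ℕ in Filter.atTop, y.abv (σ (x ^ m)) ≤ b := fun σ => by
    have := tendsto_pow_atTop_nhds_zero_of_lt_one (y.abv.nonneg _) (hx2' σ)
    filter_upwards [this.eventually (gt_mem_nhds hb0)] with m hm
    rw [map_pow, map_pow]
    exact hm.le
  obtain ⟨m, hm⟩ := (Filter.eventually_all.2 hev).exists
  have h := two_mul_pow_le_of_conj_le hv hy (x ^ m) hm
  set d := (minpoly ℚ (x ^ m)).natDegree
  have hdn : d ≤ n := minpoly.natDegree_le _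
  set X := v.abv (x ^ m)
  have hX : 1 ≤ X := by
    rw [show X = v.abv x ^ m from map_pow _ _ _]
    exact one_le_pow₀ hx1.le
  have h1 : (X + b) ^ d ≤ X ^ d * (1 + b) ^ d := by
    rw [← mul_pow]
    refine pow_le_pow_left₀ (by positivity) ?_ d
    nlinarith
  have h2 : (1 + b) ^ d ≤ (1 + b) ^ n := pow_le_pow_right₀ (by linarith) hdn
  have h3 : 0 < X ^ d := by positivity
  nlinarith

lemma exists_ringEquiv_comp_eq {A B : Type*} [Field A] [CharZero A] [Field B] [CharZero B]
    [IsAlgClosed A] [IsAlgClosed B] [Algebra.IsAlgebraic ℚ A] [Algebra.IsAlgebraic ℚ B]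
    (i : L →+* A) (j : L →+* B) : ∃ e : A ≃+* B, ∀ x, e (i x) = j x := by
  let _ := i.toAlgebra
  let _ := j.toAlgebra
  have : Algebra.IsAlgebraic L A := Algebra.IsAlgebraic.tower_top (K := ℚ) L
  have : Algebra.IsAlgebraic L B := Algebra.IsAlgebraic.tower_top (K := ℚ) L
  have : IsAlgClosure L A := ⟨inferInstance, inferInstance⟩
  have : IsAlgClosure L B := ⟨inferInstance, inferInstance⟩
  exact ⟨(IsAlgClosure.equiv L A B).toRingEquiv, fun x => (IsAlgClosure.equiv L A B).commutes x⟩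

/-- Two embeddings of a number field into `Qbar` differ by an automorphism of `Qbar`. -/
lemma exists_algEquiv_comp_eq (i j : L →+* Qbar) :
    ∃ τ : Qbar ≃ₐ[ℚ] Qbar, ∀ x, τ (i x) = j x := by
  obtain ⟨e, he⟩ := exists_ringEquiv_comp_eq i j
  exact ⟨AlgEquiv.ofRingEquiv (f := e) fun q => by simp, he⟩

lemma finite_over (q : Option Nat.Primes) : {v : Place L | v.Over q}.Finite := by
  obtain ⟨y, hy⟩ := exists_over_Qbar q
  refine (Set.finite_range fun σ : L →+* Qbar => comap σ y).subset fun v hv => ?_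
  exact exists_comap_eq hv hy

end Place

end

/-! ### The local degree counts embeddings. -/

section

namespace Place

open Polynomial UniformSpace

variable {K : Type*} [Field K] [NumberField K]

/-- The canonical embedding of a field in its completion at a place. -/
noncomputable def toCompletion {K : Type*} [Field K] [CharZero K] (v : Place K) :
    K →+* v.abv.Completion :=
  (Completion.coeRingHom (α := WithAbs v.abv)).comp (WithAbs.equiv v.abv).symm.toRingHom

lemma norm_toCompletion {K : Type*} [Field K] [CharZero K] (v : Place K) (x : K) :
    ‖v.toCompletion x‖ = v.abv x := by
  change ‖((WithAbs.toAbs v.abv x : WithAbs v.abv) : v.abv.Completion)‖ = _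
  rw [Completion.norm_coe]
  rfl

lemma denseRange_toCompletion {K : Type*} [Field K] [CharZero K] (v : Place K) :
    DenseRange v.toCompletion :=
  Completion.denseRange_coe.comp (WithAbs.equiv v.abv).symm.surjective.denseRange
    (Completion.continuous_coe _)

section

variable {v : Place K} {y : Place Qbar}

lemma isometry_toCompletion_comp {σ : K →+* Qbar} (h : comap σ y = v) :
    Isometry ((y.toCompletion.comp σ).comp (WithAbs.equiv v.abv).toRingHom) := by
  refine AddMonoidHomClass.isometry_of_norm _ fun x => ?_
  subst h
  exact norm_toCompletion y _

/-- The extension to completions of an embedding that is compatible with places. -/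
noncomputable def completionHom {σ : K →+* Qbar} (h : comap σ y = v) :
    v.abv.Completion →+* y.abv.Completion :=
  Completion.extensionHom _ (isometry_toCompletion_comp h).continuous

lemma continuous_completionHom {σ : K →+* Qbar} (h : comap σ y = v) :
    Continuous (completionHom h) :=
  Completion.continuous_extension

lemma completionHom_toCompletion {σ : K →+* Qbar} (h : comap σ y = v) (x : K) :
    completionHom h (v.toCompletion x) = y.toCompletion (σ x) :=
  Completion.extensionHom_coe _ (isometry_toCompletion_comp h).continuous (WithAbs.toAbs v.abv x)

end

/-- The closure of `ℚ` in the completion. -/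
noncomputable abbrev baseField {K : Type*} [Field K] [CharZero K] (v : Place K) :
    Subfield v.abv.Completion :=
  (⊥ : Subfield v.abv.Completion).topologicalClosure

/-- Continuous homomorphisms agree on the closure of the prime field. Hence the extensions of all
compatible embeddings are linear for one common algebra structure over `v.baseField`. -/
lemma completionHom_eq_on_baseField {v : Place K} {y : Place Qbar} {σ τ : K →+* Qbar}
    (hσ : comap σ y = v) (hτ : comap τ y = v) (x : v.baseField) :
    completionHom hσ x = completionHom hτ x := by
  let Z : Set v.abv.Completion := {x | completionHom hσ x = completionHom hτ x}
  have hZ : IsClosed Z :=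
    isClosed_eq (continuous_completionHom hσ) (continuous_completionHom hτ)
  have h : ((⊥ : Subfield v.abv.Completion) : Set v.abv.Completion) ⊆ Z := by
    have : (⊥ : Subfield v.abv.Completion) ≤
        (completionHom hσ).eqLocusField (completionHom hτ) := bot_le
    exact this
  exact closure_minimal h hZ x.2

noncomputable instance {K : Type*} [Field K] [CharZero K] (v : Place K) :
    NontriviallyNormedField v.baseField :=
  { (inferInstance : NormedField v.baseField) with
    non_trivial := by
      obtain ⟨a, h0, h1⟩ := v.exists_abv_lt_one
      refine ⟨(a : v.baseField)⁻¹, ?_⟩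
      rw [norm_inv]
      have : ‖(a : v.baseField)‖ = v.abv (a : K) := by
        rw [← norm_toCompletion, map_ratCast]
        rfl
      rw [this]
      exact (one_lt_inv₀ h0).2 h1 }

instance {K : Type*} [Field K] [CharZero K] (v : Place K) : CompleteSpace v.baseField :=
  (Subfield.isClosed_topologicalClosure _).completeSpace_coe

/-- Linear maps out of a finite-dimensional space over a complete field are continuous, so the
powers of g x tend to 0. -/
lemma norm_algHom_lt_one {F E C : Type*} [NontriviallyNormedField F] [CompleteSpace F]
    [NormedField E] [NormedAlgebra F E] [NormedField C] [NormedAlgebra F C]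
    [FiniteDimensional F E] (g : E →ₐ[F] C) {x : E} (hx : ‖x‖ < 1) :
    ‖g x‖ < 1 := by
  have hc : Continuous g := LinearMap.continuous_of_finiteDimensional g.toLinearMap
  have h1 : Filter.Tendsto (fun n : ℕ => g (x ^ n)) Filter.atTop (nhds 0) := by
    have := (hc.tendsto 0).comp (tendsto_pow_atTop_nhds_zero_of_norm_lt_one hx)
    rwa [map_zero] at this
  by_contra! h
  have h2 := (h1.norm.eventually (gt_mem_nhds (by simp : ‖(0 : C)‖ < 1))).exists
  obtain ⟨n, hn⟩ := h2
  rw [map_pow, norm_pow] at hn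
  exact hn.not_ge (one_le_pow₀ h)

section

variable {F E : Type*} [NontriviallyNormedField F] [NormedField E] [NormedAlgebra F E]

lemma range_subset_span [CharZero E] (ι : K →+* E) {α : Type*} (b : Module.Basis α ℚ K) :
    Set.range ι ⊆ Submodule.span F (Set.range fun i => ι (b i)) := by
  rintro _ ⟨x, rfl⟩
  rw [← b.linearCombination_repr x, Finsupp.linearCombination_apply, Finsupp.sum, map_sum]
  refine Submodule.sum_mem _ fun i _ => ?_
  rw [Rat.smul_def, map_mul, map_ratCast, ← map_ratCast (algebraMap F E), ← Algebra.smul_def]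
  exact Submodule.smul_mem _ _ (Submodule.subset_span ⟨i, rfl⟩)

/-- The F-span of a ℚ-basis of K is finite-dimensional, hence closed, and it contains the dense
image of K. -/
lemma span_range_eq_top [CharZero E] [CompleteSpace F] {ι : K →+* E} (hι : DenseRange ι) :
    Submodule.span F (Set.range ι) = ⊤ ∧ FiniteDimensional F E := by
  let b := Module.finBasis ℚ K
  let W : Submodule F E := Submodule.span F (Set.range fun i => ι (b i))
  have hW : Set.range ι ⊆ W := range_subset_span ι b
  have hfin : FiniteDimensional F W := FiniteDimensional.span_of_finite _ (Set.finite_range _)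
  have hclosed : IsClosed (W : Set E) := Submodule.closed_of_finiteDimensional W
  have htop : W = ⊤ := by
    rw [← SetLike.coe_set_eq, Submodule.top_coe]
    exact hclosed.closure_eq.symm.trans ((hι.mono hW).closure_eq)
  refine ⟨?_, ?_⟩
  · rw [eq_top_iff, ← htop]
    exact Submodule.span_mono (by rintro _ ⟨i, rfl⟩; exact ⟨_, rfl⟩)
  · rw [htop] at hfin
    exact Module.Finite.of_surjective (⊤ : Submodule F E).subtype (fun x => ⟨⟨x, trivial⟩, rfl⟩)

variable {C : Type*} [NormedField C] [NormedAlgebra F C]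

/-- The minimal polynomial of an element of `K` over a larger field splits in any field containing
all algebraic numbers. -/
lemma splits_minpoly_map [CharZero F] (ι : K →+* E) (j : Qbar →+* C) (x : K) :
    ((minpoly F (ι x)).map (algebraMap F C)).Splits := by
  have hint : IsIntegral ℚ x := Algebra.IsIntegral.isIntegral x
  have hdvd : minpoly F (ι x) ∣ (minpoly ℚ x).map (algebraMap ℚ F) := by
    refine minpoly.dvd _ _ ?_
    rw [aeval_def, eval₂_map, Subsingleton.elim ((algebraMap F E).comp (algebraMap ℚ F))
      (ι.comp (algebraMap ℚ K)), ← hom_eval₂, ← aeval_def, minpoly.aeval, map_zero]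
  have hspl : (((minpoly ℚ x).map (algebraMap ℚ F)).map (algebraMap F C)).Splits := by
    rw [Polynomial.map_map, Subsingleton.elim ((algebraMap F C).comp (algebraMap ℚ F))
      (j.comp (algebraMap ℚ Qbar)), ← Polynomial.map_map]
    exact (IsAlgClosed.splits _).map _
  refine hspl.of_dvd ?_ (Polynomial.map_dvd _ hdvd)
  rw [Polynomial.map_map]
  exact Polynomial.map_ne_zero (minpoly.ne_zero hint)

/-- A primitive element of K generates E over F, and its minimal polynomial over F is separable and
splits in C. -/
lemma natCard_algHom_eq_finrank [CharZero F] [CharZero E] [CompleteSpace F] {ι : K →+* E}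
    (hι : DenseRange ι) (j : Qbar →+* C) :
    Nat.card (E →ₐ[F] C) = Module.finrank F E := by
  obtain ⟨hspan, hfin⟩ := span_range_eq_top (F := F) hι
  let α := Field.powerBasisOfFiniteOfSeparable ℚ K
  have hadj : Algebra.adjoin F {ι α.gen} = ⊤ := by
    rw [← Algebra.toSubmodule_eq_top, eq_top_iff, ← hspan, Submodule.span_le]
    refine (range_subset_span ι α.basis).trans (Submodule.span_le.2 ?_)
    rintro _ ⟨i, rfl⟩
    simp only [PowerBasis.coe_basis, map_pow]
    exact pow_mem (Algebra.subset_adjoin (Set.mem_singleton (ι α.gen))) _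
  let pb := PowerBasis.ofAdjoinEqTop (Algebra.IsIntegral.isIntegral (R := F) (ι α.gen)) hadj
  have hgen : pb.gen = ι α.gen := PowerBasis.ofAdjoinEqTop_gen _ _
  rw [AlgHom.natCard_of_powerBasis pb (Algebra.IsSeparable.isSeparable _ _)
    (by rw [hgen]; exact splits_minpoly_map ι j _), pb.finrank]

/-- A homomorphism from `K` to a field containing all algebraic numbers factors through them. -/
lemma exists_comp_eq (j : Qbar →+* C) (g : K →+* C) : ∃ σ : K →+* Qbar, j.comp σ = g := by
  have : CharZero C := charZero_of_injective_ringHom j.injective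
  have h : ∀ x, g x ∈ j.range := by
    intro x
    have hint : IsIntegral ℚ x := Algebra.IsIntegral.isIntegral x
    have hroot : g x ∈ ((minpoly ℚ x).map (algebraMap ℚ C)).roots := by
      rw [mem_roots (Polynomial.map_ne_zero (minpoly.ne_zero hint)), IsRoot.def, eval_map,
        Subsingleton.elim (algebraMap ℚ C) (g.comp (algebraMap ℚ K)), ← hom_eval₂, ← aeval_def,
        minpoly.aeval, map_zero]
    rw [Subsingleton.elim (algebraMap ℚ C) (j.comp (algebraMap ℚ Qbar)), ← Polynomial.map_map,
      (IsAlgClosed.splits ((minpoly ℚ x).map (algebraMap ℚ Qbar))).roots_map,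
      Multiset.mem_map] at hroot
    obtain ⟨z, -, hz⟩ := hroot
    exact ⟨z, hz⟩
  let e : Qbar ≃+* j.range := RingEquiv.ofBijective j.rangeRestrict
    ⟨fun a b hab => j.injective (congrArg Subtype.val hab), j.rangeRestrict_surjective⟩
  refine ⟨(e.symm : j.range →+* Qbar).comp (g.codRestrict j.range h), ?_⟩
  ext x
  have := e.apply_symm_apply ⟨g x, h x⟩
  exact congrArg Subtype.val this

/-- Embeddings inducing v correspond to F-algebra homomorphisms E → C. Conversely to `hext`, such a
homomorphism restricted to K has algebraic values, so it comes from some σ, and its continuity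
forces σ to induce v. -/
theorem natCard_comap_eq_finrank [CharZero F] [CharZero E] [CompleteSpace F]
    {v : Place K} {y : Place Qbar} {q : Option Nat.Primes}
    (hv : v.Over q) (hy : y.Over q) {ι : K →+* E} (hι : DenseRange ι)
    (hιv : ∀ x, ‖ι x‖ = v.abv x) {j : Qbar →+* C} (hj : ∀ x, ‖j x‖ = y.abv x)
    (hext : ∀ σ : K →+* Qbar, comap σ y = v → ∃ g : E →ₐ[F] C, ∀ x, g (ι x) = j (σ x)) :
    Nat.card {σ : K →+* Qbar // comap σ y = v} = Module.finrank F E := by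
  rw [← natCard_algHom_eq_finrank (F := F) hι j]
  obtain ⟨hspan, hfin⟩ := span_range_eq_top (F := F) hι
  choose f hf using hext
  refine Nat.card_eq_of_bijective (fun σ : {σ : K →+* Qbar // comap σ y = v} => f σ.1 σ.2)
    ⟨fun σ τ h => ?_, fun g => ?_⟩
  · refine Subtype.ext (RingHom.ext fun x => j.injective ?_)
    rw [← hf _ σ.2, ← hf _ τ.2]
    exact DFunLike.congr_fun h _
  · obtain ⟨σ, hσ⟩ := exists_comp_eq j ((g : E →+* C).comp ι)
    have hσ' : ∀ x, j (σ x) = g (ι x) := fun x => DFunLike.congr_fun hσ x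
    have hcomap : comap σ y = v := by
      refine (eq_of_lt_one_imp hv (hy.comap σ) fun x hx => ?_).symm
      rw [comap_abv_apply, ← hj, hσ']
      exact norm_algHom_lt_one g (by rwa [hιv])
    refine ⟨⟨σ, hcomap⟩, ?_⟩
    have : (f σ hcomap).toLinearMap = g.toLinearMap := by
      refine LinearMap.ext_on hspan ?_
      rintro _ ⟨x, rfl⟩
      exact (hf σ hcomap x).trans (hσ' x)
    exact AlgHom.toLinearMap_injective this

end

noncomputable instance {K : Type*} [Field K] [CharZero K] (v : Place K) :
    NormedAlgebra v.baseField v.abv.Completion where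
  norm_smul_le _ _ := norm_mul_le _ _

/-- The number of embeddings of `K` in `Qbar` that induce the place `v` is the local degree. -/
theorem natCard_comap_eq_localDegree {v : Place K} {y : Place Qbar} {q : Option Nat.Primes}
    (hv : v.Over q) (hy : y.Over q) :
    Nat.card {σ : K →+* Qbar // comap σ y = v} = v.localDegree := by
  obtain ⟨σ₀, hσ₀⟩ := exists_comap_eq hv hy
  -- The algebra structure is taken from one embedding σ₀; the other compatible embeddings give the
  -- same one.
  let φ₀ : v.baseField →+* y.abv.Completion := (completionHom hσ₀).comp v.baseField.subtype
  have hnorm : ∀ x, ‖completionHom hσ₀ x‖ = ‖x‖ := 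
    AddMonoidHomClass.isometry_iff_norm _ |>.1
      (isometry_toCompletion_comp hσ₀).completion_extension
  have : CharZero v.abv.Completion := charZero_of_injective_ringHom v.toCompletion.injective
  let _ : NormedAlgebra v.baseField y.abv.Completion :=
    { φ₀.toAlgebra with
      norm_smul_le := fun r x => by
        change ‖φ₀ r * x‖ ≤ ‖r‖ * ‖x‖
        rw [norm_mul]
        exact le_of_eq (congrArg (· * ‖x‖) (hnorm _)) }
  refine natCard_comap_eq_finrank hv hy v.denseRange_toCompletion (norm_toCompletion v)
    (norm_toCompletion y) fun σ hσ => ⟨{ completionHom hσ with commutes' := fun r => ?_ },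
      completionHom_toCompletion hσ⟩
  exact completionHom_eq_on_baseField hσ hσ₀ r

end Place

end

/-! ### The topology of Y and the Galois action. -/

section

/-- With l an extension of k through j and A one through σ, this combines the count of k-algebra
homomorphisms l → A with the tower law. -/
lemma natCard_extensions {k l A : Type*} [Field k] [NumberField k] [Field l] [NumberField l]
    [Field A] [CharZero A] [IsAlgClosed A] (j : k →+* l) (σ : k →+* A) :
    Module.finrank ℚ k * Nat.card {τ : l →+* A // τ.comp j = σ} = Module.finrank ℚ l := by
  let _ := j.toAlgebra
  let _ := σ.toAlgebra
  have : FiniteDimensional k l := Module.Finite.of_restrictScalars_finite ℚ k l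
  rw [← Module.finrank_mul_finrank ℚ k l, ← AlgHom.card k l A, Fintype.card_eq_nat_card]
  congr 1
  refine Nat.card_congr
    { toFun := fun τ => { τ.1 with commutes' := fun x => DFunLike.congr_fun τ.2 x }
      invFun := fun τ => ⟨τ.toRingHom, τ.comp_algebraMap⟩
      left_inv := fun _ => rfl
      right_inv := fun _ => rfl }

namespace Place

instance : IsAlgClosure ℚ Qbar := ⟨inferInstance, inferInstance⟩

instance : Normal ℚ Qbar := IsAlgClosure.normal ℚ Qbar

instance : IsGalois ℚ Qbar where

/-- A finite Galois extension of `ℚ` inside `Qbar` that contains a given number field. -/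
lemma exists_galois_intermediateField {k : Type*} [Field k] [NumberField k] (i : k →+* Qbar) :
    ∃ l : IntermediateField ℚ Qbar, FiniteDimensional ℚ l ∧ IsGalois ℚ l ∧
      ∃ j : k →+* l, (algebraMap l Qbar).comp j = i := by
  let r := i.toRatAlgHom.fieldRange
  have : FiniteDimensional ℚ r := 
    Module.Finite.of_surjective i.toRatAlgHom.rangeRestrict.toLinearMap
      i.toRatAlgHom.rangeRestrict_surjective
  let l := IntermediateField.normalClosure ℚ r Qbar
  have hr : r ≤ l := IntermediateField.le_normalClosure r
  refine ⟨l, inferInstance, ?_, i.codRestrict l.toSubfield fun x => hr ⟨x, rfl⟩, rfl⟩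
  -- Two ℚ-algebra structures on l occur; they agree because such a structure is unique.
  have h : @Normal ℚ l _ _ l.algebra' := normalClosure.normal ℚ r Qbar
  have : Normal ℚ l := by
    convert h
    exact Subsingleton.elim _ _
  constructor

lemma isOpen_galois_fiber (l : IntermediateField ℚ Qbar) [h1 : FiniteDimensional ℚ l]
    [h2 : IsGalois ℚ l] (w : Place l) : IsOpen w.fiber :=
  TopologicalSpace.isOpen_generateFrom_of_mem ⟨l, h1, h2, w, rfl⟩

/-- The topology is generated by Galois fields only; for general k the fiber is the union of the
fibers over the places above v of a Galois field containing k. -/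
lemma isOpen_fiber {k : Type*} [Field k] [NumberField k] [Algebra k Qbar] (v : Place k) :
    IsOpen v.fiber := by
  obtain ⟨l, h1, h2, j, hj⟩ := exists_galois_intermediateField (algebraMap k Qbar)
  have : v.fiber = ⋃ w : {w : Place l // comap j w = v}, w.1.fiber := by
    ext y
    simp only [Set.mem_iUnion, Subtype.exists, exists_prop, fiber, Set.mem_ofPred_eq,
      restrict_eq_comap]
    constructor
    · intro h
      exact ⟨comap (algebraMap l Qbar) y, by rw [comap_comap, hj, h], rfl⟩
    · rintro ⟨w, rfl, rfl⟩
      rw [comap_comap, hj]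
  rw [this]
  exact isOpen_iUnion fun w => isOpen_galois_fiber l w.1

/-- Distinct places differ at some x, hence already on the number field ℚ(x), whose fibers separate
them. -/
instance : T2Space (Place Qbar) := by
  refine ⟨fun y y' hne => ?_⟩
  obtain ⟨x, hx⟩ : ∃ x, y.abv x ≠ y'.abv x := by
    by_contra! h
    exact hne (ext_abv h)
  let k := IntermediateField.adjoin ℚ {x}
  have : FiniteDimensional ℚ k :=
    IntermediateField.adjoin.finiteDimensional (Algebra.IsIntegral.isIntegral x)
  have : NumberField k := ⟨⟩
  refine ⟨_, _, isOpen_fiber (y.restrict k), isOpen_fiber (y'.restrict k), rfl, rfl, ?_⟩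
  refine Set.disjoint_left.2 fun z (hz : _ = _) (hz' : _ = _) => hx ?_
  have h := congrArg (fun w : Place k =>
    w.abv ⟨x, IntermediateField.mem_adjoin_simple_self ℚ x⟩) (hz.symm.trans hz')
  exact h

/-- The set of places of `Qbar` over `q` is open. -/
lemma isOpen_over (q : Option Nat.Primes) : IsOpen {y : Place Qbar | y.Over q} := by
  have : {y : Place Qbar | y.Over q} = ⋃ v : {v : Place ℚ // v.Over q}, v.1.fiber := by
    ext y
    simp only [Set.mem_iUnion, Subtype.exists, exists_prop, fiber, Set.mem_ofPred_eq,
      restrict_eq_comap]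
    exact ⟨fun h => ⟨comap (algebraMap ℚ Qbar) y, h.comap _, rfl⟩,
      fun ⟨v, hv, hy⟩ => (over_comap_iff (algebraMap ℚ Qbar)).1 (hy ▸ hv)⟩
  rw [this]
  exact isOpen_iUnion fun w => isOpen_fiber w.1

section Galois

/-- Membership depends only on τ⁻¹ on the image of i, and the fixing subgroup of a finite extension
is open. -/
lemma isOpen_setOf_symm_comp {k : Type*} [Field k] [NumberField k] (i : k →+* Qbar)
    (s : Set (k →+* Qbar)) : IsOpen {τ : Qbar ≃ₐ[ℚ] Qbar | (τ.symm : Qbar →+* Qbar).comp i ∈ s} := by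
  rw [isOpen_iff_mem_nhds]
  intro τ hτ
  let r := i.toRatAlgHom.fieldRange
  have : FiniteDimensional ℚ r := 
    Module.Finite.of_surjective i.toRatAlgHom.rangeRestrict.toLinearMap
      i.toRatAlgHom.rangeRestrict_surjective
  have hopen : IsOpen ((fun τ' : (Qbar ≃ₐ[ℚ] Qbar) => τ * τ'⁻¹) ⁻¹' (r.fixingSubgroup : Set (Qbar ≃ₐ[ℚ] Qbar))) :=
    r.fixingSubgroup_isOpen.preimage (by fun_prop)
  refine Filter.mem_of_superset (hopen.mem_nhds (by simp)) fun τ' hτ' => ?_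
  have h : (τ'.symm : Qbar →+* Qbar).comp i = (τ.symm : Qbar →+* Qbar).comp i := by
    ext x
    have := (IntermediateField.mem_fixingSubgroup_iff _ _).1 hτ' (i x) ⟨x, rfl⟩
    exact (τ.symm_apply_eq.2 this.symm).symm
  simpa only [Set.mem_ofPred_eq, h] using hτ

lemma continuous_galois (y : Place Qbar) : Continuous fun τ : (Qbar ≃ₐ[ℚ] Qbar) => galois τ y := by
  refine continuous_generateFrom_iff.2 ?_
  rintro _ ⟨l, h1, h2, w, rfl⟩
  have : NumberField l := ⟨⟩
  exact isOpen_setOf_symm_comp (algebraMap l Qbar) {σ | comap σ y = w}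

end Galois

end Place

end

/-! ### Construction of λ from Haar measure, and its values on fibers. -/

section

namespace Place

section Haar

noncomputable local instance : MeasurableSpace (Qbar ≃ₐ[ℚ] Qbar) := borel (Qbar ≃ₐ[ℚ] Qbar)
local instance : BorelSpace (Qbar ≃ₐ[ℚ] Qbar) := ⟨rfl⟩

/-- The normalized Haar measure of the absolute Galois group. -/
noncomputable def galoisHaar : Measure (Qbar ≃ₐ[ℚ] Qbar) := Measure.haarMeasure ⊤

instance : galoisHaar.IsHaarMeasure := by unfold galoisHaar; infer_instance

instance : IsProbabilityMeasure galoisHaar :=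
  ⟨Measure.haarMeasure_self (K₀ := (⊤ : TopologicalSpace.PositiveCompacts (Qbar ≃ₐ[ℚ] Qbar)))⟩

/-- A compact group is unimodular: a right translate is again a Haar probability measure. -/
instance : galoisHaar.IsMulRightInvariant where
  map_mul_right_eq_self g := by
    have : IsProbabilityMeasure (galoisHaar.map (· * g)) :=
      Measure.isProbabilityMeasure_map (measurable_mul_const g).aemeasurable
    exact Measure.isHaarMeasure_eq_of_isProbabilityMeasure _ _

variable {k : Type*} [Field k] [NumberField k]

/-- Right translation by an automorphism ρ with ρ ∘ σ = σ' carries one set to the other. -/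
lemma galoisHaar_symm_comp_eq (i σ σ' : k →+* Qbar) :
    galoisHaar {τ : Qbar ≃ₐ[ℚ] Qbar | (τ.symm : Qbar →+* Qbar).comp i = σ} =
      galoisHaar {τ : Qbar ≃ₐ[ℚ] Qbar | (τ.symm : Qbar →+* Qbar).comp i = σ'} := by
  obtain ⟨ρ, hρ⟩ := exists_algEquiv_comp_eq σ σ'
  rw [← measure_preimage_mul_right galoisHaar ρ]
  congr 1
  ext τ
  have h : ∀ x, ((τ * ρ).symm : Qbar →+* Qbar) (i x) = ρ.symm (τ.symm (i x)) := fun _ => rfl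
  simp only [Set.mem_ofPred_eq, Set.mem_preimage, RingHom.ext_iff, RingHom.comp_apply, h, ← hρ]
  exact forall_congr' fun x => ρ.symm_apply_eq

/-- The automorphisms whose inverse restricts to one of a given set of embeddings. -/
lemma galoisHaar_symm_comp_mem (i : k →+* Qbar) (s : Set (k →+* Qbar)) :
    galoisHaar {τ : Qbar ≃ₐ[ℚ] Qbar | (τ.symm : Qbar →+* Qbar).comp i ∈ s} =
      (Nat.card s : ℝ≥0∞) / (Module.finrank ℚ k : ℝ≥0∞) := by
  classical
  set c := galoisHaar {τ : Qbar ≃ₐ[ℚ] Qbar | (τ.symm : Qbar →+* Qbar).comp i = i}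
  have key : ∀ t : Finset (k →+* Qbar),
      galoisHaar {τ : Qbar ≃ₐ[ℚ] Qbar | (τ.symm : Qbar →+* Qbar).comp i ∈ t} = t.card * c := by
    intro t
    have : {τ : Qbar ≃ₐ[ℚ] Qbar | (τ.symm : Qbar →+* Qbar).comp i ∈ t} =
        ⋃ σ ∈ t, {τ : Qbar ≃ₐ[ℚ] Qbar | (τ.symm : Qbar →+* Qbar).comp i = σ} := by
      ext τ; simp
    rw [this, measure_biUnion_finset]
    · rw [Finset.sum_congr rfl fun σ _ => galoisHaar_symm_comp_eq i σ i, Finset.sum_const,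
        nsmul_eq_mul]
    · intro σ _ σ' _ h
      exact Set.disjoint_left.2 fun τ h1 h2 => h (h1.symm.trans h2)
    · intro σ _
      exact (isOpen_setOf_symm_comp i {σ}).measurableSet
  -- The [k : ℚ] embeddings share the total mass 1 equally, which determines c.
  have h1 := key Finset.univ
  simp only [Finset.mem_univ, Set.ofPred_true, measure_univ, Finset.card_univ] at h1
  rw [NumberField.Embeddings.card] at h1
  have hn : (Module.finrank ℚ k : ℝ≥0∞) ≠ 0 := by
    exact_mod_cast (Module.finrank_pos (R := ℚ) (M := k)).ne'
  have hc : c = (Module.finrank ℚ k : ℝ≥0∞)⁻¹ :=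
    ENNReal.eq_inv_of_mul_eq_one_left (by rw [mul_comm, ← h1])
  have := key s.toFinite.toFinset
  simp only [Set.Finite.mem_toFinset] at this
  rw [this, hc, div_eq_mul_inv, Nat.card_eq_card_finite_toFinset]

/-- A place of `Qbar` over `q`. -/
noncomputable def basePoint (q : Option Nat.Primes) : Place Qbar := (exists_over_Qbar q).choose

lemma basePoint_over (q : Option Nat.Primes) : (basePoint q).Over q :=
  (exists_over_Qbar q).choose_spec

/-- The invariant probability measure on the places over `q`. -/
noncomputable def orbitMeasure (q : Option Nat.Primes) : Measure (Place Qbar) :=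
  galoisHaar.map fun τ => galois τ (basePoint q)

lemma orbitMeasure_apply (q : Option Nat.Primes) {E : Set (Place Qbar)} (hE : MeasurableSet E) :
    orbitMeasure q E = galoisHaar {τ | galois τ (basePoint q) ∈ E} :=
  Measure.map_apply (continuous_galois _).measurable hE

instance (q : Option Nat.Primes) : (orbitMeasure q).InnerRegular :=
  Measure.InnerRegular.map_of_continuous (continuous_galois _)

instance (q : Option Nat.Primes) : IsProbabilityMeasure (orbitMeasure q) :=
  Measure.isProbabilityMeasure_map (continuous_galois _).measurable.aemeasurable

lemma over_galois {y : Place Qbar} {q : Option Nat.Primes} (h : y.Over q) (τ : (Qbar ≃ₐ[ℚ] Qbar)) :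
    (galois τ y).Over q := h.comap (τ.symm : Qbar →+* Qbar)

lemma orbitMeasure_eq_zero {q r : Option Nat.Primes} (h : q ≠ r) {E : Set (Place Qbar)}
    (hE : MeasurableSet E) (hEr : ∀ y ∈ E, y.Over r) : orbitMeasure q E = 0 := by
  rw [orbitMeasure_apply q hE]
  convert measure_empty (μ := galoisHaar)
  refine Set.eq_empty_of_forall_notMem fun τ hτ => h ?_
  exact (over_galois (basePoint_over q) τ).unique (hEr _ hτ)

/-- The translate of y by τ lies over v exactly when τ⁻¹ restricted to k induces v from y; the local
degree counts these restrictions among [k : ℚ] equally likely ones. -/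
lemma orbitMeasure_fiber [Algebra k Qbar] {v : Place k} {q : Option Nat.Primes} (hv : v.Over q) :
    orbitMeasure q v.fiber = (v.localDegree : ℝ≥0∞) / (Module.finrank ℚ k : ℝ≥0∞) := by
  rw [orbitMeasure_apply q (isOpen_fiber v).measurableSet,
    ← natCard_comap_eq_localDegree hv (basePoint_over q)]
  exact galoisHaar_symm_comp_mem (algebraMap k Qbar) {σ | comap σ (basePoint q) = v}

lemma galois_mul (τ ρ : (Qbar ≃ₐ[ℚ] Qbar)) (y : Place Qbar) : galois (τ * ρ) y = galois τ (galois ρ y) := rfl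

lemma galois_one (y : Place Qbar) : galois 1 y = y := rfl

/-- The image of a set of places under an automorphism is its preimage under the inverse. -/
lemma galois_image_eq_preimage (τ : (Qbar ≃ₐ[ℚ] Qbar)) (E : Set (Place Qbar)) :
    galois τ '' E = galois τ⁻¹ ⁻¹' E := by
  refine congrFun (Set.image_eq_preimage_of_inverse (fun y => ?_) (fun y => ?_)) E <;>
    rw [← galois_mul] <;> simp [galois_one]

lemma continuous_galois_right (τ : (Qbar ≃ₐ[ℚ] Qbar)) : Continuous (galois τ) := by
  refine continuous_generateFrom_iff.2 ?_
  rintro _ ⟨l, h1, h2, w, rfl⟩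
  have : NumberField l := ⟨⟩
  -- The preimage of Y(l, w) is again a fiber of w, for l embedded in `Qbar` through τ⁻¹.
  let _ : Algebra l Qbar := ((τ.symm : Qbar →+* Qbar).comp (algebraMap l Qbar)).toAlgebra
  exact isOpen_fiber (k := l) w

lemma orbitMeasure_image (q : Option Nat.Primes) (τ : (Qbar ≃ₐ[ℚ] Qbar)) {E : Set (Place Qbar)}
    (hE : MeasurableSet E) : orbitMeasure q (galois τ '' E) = orbitMeasure q E := by
  rw [galois_image_eq_preimage, orbitMeasure_apply q hE,
    orbitMeasure_apply q ((continuous_galois_right _).measurable hE),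
    ← measure_preimage_mul galoisHaar τ⁻¹ {ρ | galois ρ (basePoint q) ∈ E}]
  rfl

lemma sum_orbitMeasure_apply {q : Option Nat.Primes} {E : Set (Place Qbar)}
    (hE : MeasurableSet E) (hEq : ∀ y ∈ E, y.Over q) :
    Measure.sum orbitMeasure E = orbitMeasure q E := by
  rw [Measure.sum_apply _ hE]
  exact tsum_eq_single q fun r hr => orbitMeasure_eq_zero hr hE hEq

lemma sum_orbitMeasure_over (q : Option Nat.Primes) :
    Measure.sum orbitMeasure {y | y.Over q} < ∞ := by
  rw [sum_orbitMeasure_apply (isOpen_over q).measurableSet fun _ h => h]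
  exact measure_lt_top _ _

/-- The total mass is infinite, 1 for each place of ℚ, so outer regularity is checked on countably
many open pieces of finite mass. -/
instance : (Measure.sum orbitMeasure).OuterRegular := by
  obtain ⟨e, he⟩ := exists_surjective_nat (Option Nat.Primes)
  refine Measure.OuterRegular.of_restrict (s := fun n => {y | y.Over (e n)}) (fun n => ?_)
    (fun n => isOpen_over _) fun y _ => ?_
  · have : IsFiniteMeasure ((Measure.sum orbitMeasure).restrict {y | y.Over (e n)}) :=
      ⟨by rw [Measure.restrict_apply_univ]; exact sum_orbitMeasure_over _⟩
    infer_instance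
  · obtain ⟨q, hq⟩ := y.exists_over
    obtain ⟨n, rfl⟩ := he q
    exact Set.mem_iUnion.2 ⟨n, hq⟩

instance : IsLocallyFiniteMeasure (Measure.sum orbitMeasure) where
  finiteAtNhds y := by
    obtain ⟨q, hq⟩ := y.exists_over
    exact ⟨_, (isOpen_over q).mem_nhds hq, sum_orbitMeasure_over q⟩

lemma fiber_over {k : Type*} [Field k] [CharZero k] [Algebra k Qbar] {v : Place k}
    {q : Option Nat.Primes} (hv : v.Over q) {y : Place Qbar} (hy : y ∈ v.fiber) : y.Over q :=
  (over_comap_iff (algebraMap k Qbar)).1 ((show comap _ y = v from hy) ▸ hv)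

theorem isNormalizedInvariant_sum_orbitMeasure :
    IsNormalizedInvariant (Measure.sum orbitMeasure) where
  regular :=
    { innerRegular := Measure.InnerRegular.innerRegular.mono (fun U hU => hU.measurableSet)
        fun _ h => h }
  invariant τ E hE := by
    have hE' : MeasurableSet (galois τ '' E) := by
      rw [galois_image_eq_preimage]
      exact (continuous_galois_right _).measurable hE
    rw [Measure.sum_apply _ hE, Measure.sum_apply _ hE']
    exact tsum_congr fun q => orbitMeasure_image q τ hE
  fiber l h1 h2 w := by
    have : NumberField l := ⟨⟩
    obtain ⟨q, hq⟩ := w.exists_over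
    rw [sum_orbitMeasure_apply (isOpen_fiber w).measurableSet fun _ h => fiber_over hq h,
      orbitMeasure_fiber hq]

end Haar

/-- Existence alone gives content to the choice in `placeMeasure`: whichever measure is chosen, its
values on the fibers of Galois fields are prescribed. -/
theorem isNormalizedInvariant_placeMeasure : IsNormalizedInvariant placeMeasure :=
  Classical.epsilon_spec ⟨_, isNormalizedInvariant_sum_orbitMeasure⟩

lemma natCard_preimage_eq_sum {α β : Type*} [Finite α] (f : α → β) (t : Finset β) :
    Nat.card {a // f a ∈ t} = ∑ b ∈ t, Nat.card {a // f a = b} := by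
  classical
  have := Fintype.ofFinite α
  simp only [Nat.card_eq_fintype_card, Fintype.card_subtype]
  rw [Finset.card_eq_sum_card_fiberwise (f := f) (t := t) fun a ha => by simpa using ha]
  refine Finset.sum_congr rfl fun b hb => congrArg Finset.card ?_
  ext a
  simp only [Finset.mem_filter, Finset.mem_univ, true_and, and_iff_right_iff_imp]
  rintro rfl
  exact hb

/-- The places above a place of a smaller field, weighted by their local degrees. -/
lemma finrank_mul_sum_localDegree {k l : Type*} [Field k] [NumberField k] [Field l] [NumberField l]
    (j : k →+* l) (v : Place k) (t : Finset (Place l)) (ht : ∀ w, w ∈ t ↔ comap j w = v) :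
    Module.finrank ℚ k * ∑ w ∈ t, w.localDegree = Module.finrank ℚ l * v.localDegree := by
  obtain ⟨q, hq⟩ := v.exists_over
  obtain ⟨y, hy⟩ := exists_over_Qbar q
  -- Embeddings of l inducing v on k are counted in two ways: by the place induced on l, and by
  -- their restriction to k, each restriction having [l : k] extensions.
  have h1 : ∀ w ∈ t, w.localDegree = Nat.card {σ : l →+* Qbar // comap σ y = w} := fun w hw =>
    (natCard_comap_eq_localDegree ((over_comap_iff j).1 (((ht w).1 hw) ▸ hq)) hy).symm
  rw [Finset.sum_congr rfl h1, ← natCard_preimage_eq_sum (fun σ : l →+* Qbar => comap σ y) t]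
  simp only [ht, comap_comap]
  have hfin : {σ : k →+* Qbar | comap σ y = v}.Finite := Set.toFinite _
  have h2 := natCard_preimage_eq_sum (fun σ : l →+* Qbar => σ.comp j) hfin.toFinset
  simp only [Set.Finite.mem_toFinset, Set.mem_ofPred_eq] at h2
  rw [h2, Finset.mul_sum, Finset.sum_congr rfl fun σ _ => natCard_extensions j σ,
    Finset.sum_const, ← natCard_comap_eq_localDegree hq hy, smul_eq_mul, mul_comm]
  congr 1
  exact (Nat.card_eq_card_finite_toFinset hfin).symm

/-- The value is prescribed for Galois fields; in general the fiber splits into fibers over a larger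
Galois field, whose local degrees add up by `finrank_mul_sum_localDegree`. -/
theorem placeMeasure_fiber {k : Type*} [Field k] [NumberField k] [Algebra k Qbar] (v : Place k) :
    placeMeasure v.fiber = (v.localDegree : ℝ≥0∞) / (Module.finrank ℚ k : ℝ≥0∞) := by
  obtain ⟨l, h1, h2, j, hj⟩ := exists_galois_intermediateField (algebraMap k Qbar)
  have : NumberField l := ⟨⟩
  obtain ⟨q, hq⟩ := v.exists_over
  have hfin : {w : Place l | comap j w = v}.Finite :=
    (finite_over q).subset fun w hw => (over_comap_iff j).1 (hw ▸ hq)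
  have hmem : ∀ w, w ∈ hfin.toFinset ↔ comap j w = v := fun w => hfin.mem_toFinset
  have hunion : v.fiber = ⋃ w ∈ hfin.toFinset, w.fiber := by
    ext y
    simp only [Set.mem_iUnion, exists_prop, fiber, Set.mem_ofPred_eq, restrict_eq_comap, hmem]
    constructor
    · intro h
      exact ⟨comap (algebraMap l Qbar) y, by rw [comap_comap, hj, h], rfl⟩
    · rintro ⟨w, rfl, rfl⟩
      rw [comap_comap, hj]
  rw [hunion, measure_biUnion_finset
    (fun w _ w' _ h => Set.disjoint_left.2 fun y hy hy' => h (hy.symm.trans hy'))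
    (fun w _ => (isOpen_fiber w).measurableSet),
    Finset.sum_congr rfl fun w _ => isNormalizedInvariant_placeMeasure.fiber l h1 h2 w]
  simp only [div_eq_mul_inv]
  rw [← Finset.sum_mul, ← Nat.cast_sum]
  have key := congrArg (Nat.cast (R := ℝ≥0∞)) (finrank_mul_sum_localDegree j v _ hmem)
  simp only [Nat.cast_mul] at key
  have hk : (Module.finrank ℚ k : ℝ≥0∞) ≠ 0 := by
    exact_mod_cast (Module.finrank_pos (R := ℚ) (M := k)).ne'
  have hl : (Module.finrank ℚ l : ℝ≥0∞) ≠ 0 := by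
    exact_mod_cast (Module.finrank_pos (R := ℚ) (M := l)).ne'
  rw [← div_eq_mul_inv, ← div_eq_mul_inv, ENNReal.div_eq_div_iff hk (by simp) hl (by simp)]
  exact key

lemma placeMeasure_over_lt_top (q : Option Nat.Primes) : placeMeasure {y | y.Over q} < ∞ := by
  have h : {y : Place Qbar | y.Over q} ⊆ ((basePoint q).restrict ℚ).fiber := fun y hy =>
    ext_abv fun x => (hy x).trans (basePoint_over q x).symm
  refine (measure_mono h).trans_lt ?_
  rw [placeMeasure_fiber]
  exact ENNReal.div_lt_top (by simp) (by simp)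

/-- This makes the product measure multiplicative on boxes. -/
instance : SigmaFinite placeMeasure := by
  obtain ⟨e, he⟩ := exists_surjective_nat (Option Nat.Primes)
  refine ⟨⟨⟨fun n => {y | y.Over (e n)}, fun _ => trivial, fun n => placeMeasure_over_lt_top _, ?_⟩⟩⟩
  refine Set.eq_univ_of_forall fun y => ?_
  obtain ⟨q, hq⟩ := y.exists_over
  obtain ⟨n, rfl⟩ := he q
  exact Set.mem_iUnion.2 ⟨n, hq⟩

end Place

end

/-! ### Finite places and prime ideals. -/

section

open scoped NNReal

namespace Place

open Polynomial NumberField IsDedekindDomain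

/-- The valuation attached to a place over a prime. -/
def Over.valuation {K : Type*} [Field K] [CharZero K] {v : Place K} {p : Nat.Primes}
    (hv : v.Over (some p)) : Valuation K ℝ≥0 where
  toFun x := (⟨v.abv x, v.abv.nonneg x⟩ : ℝ≥0)
  map_zero' := NNReal.eq v.abv.map_zero
  map_one' := NNReal.eq v.abv.map_one
  map_mul' x y := NNReal.eq (v.abv.map_mul x y)
  map_add_le_max' x y := le_max_iff.2 ((le_max_iff.1 (hv.add_le_max x y)).imp id id)

lemma Over.valuation_le_one_iff {K : Type*} [Field K] [CharZero K] {v : Place K} {p : Nat.Primes}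
    (hv : v.Over (some p)) (x : K) : hv.valuation x ≤ 1 ↔ v.abv x ≤ 1 := by
  rw [← NNReal.coe_le_coe]; rfl

lemma Over.abv_le_one_of_isIntegral {K : Type*} [Field K] [CharZero K] {v : Place K}
    {p : Nat.Primes} (hv : v.Over (some p)) {x : K} (hx : IsIntegral ℤ x) : v.abv x ≤ 1 := by
  rw [← hv.valuation_le_one_iff]
  exact (Valuation.integer.integers hv.valuation).mem_of_integral (hx.tower_top)

/-- A rational number which is integral at all primes is an integer. -/
lemma exists_int_of_ratAbv_le_one {a : ℚ} (h : ∀ p : Nat.Primes, ratAbv (some p) a ≤ 1) :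
    ∃ n : ℤ, (n : ℚ) = a := by
  refine ⟨a.num, Rat.coe_int_num_of_den_eq_one ?_⟩
  by_contra hd
  obtain ⟨p, hp, hpd⟩ := Nat.exists_prime_and_dvd hd
  have : Fact p.Prime := ⟨hp⟩
  have h1 : ‖(a : ℚ_[p])‖ ≤ 1 := by
    rw [Padic.eq_padicNorm]
    exact h ⟨p, hp⟩
  have h2 := PadicInt.isUnit_iff.1 (PadicInt.isUnit_den a h1)
  have h3 : ‖((a.den : ℤ) : ℤ_[p])‖ < 1 := by
    rw [PadicInt.norm_int_lt_one_iff_dvd]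
    exact_mod_cast hpd
  rw [Int.cast_natCast, h2] at h3
  exact lt_irrefl _ h3

variable {k : Type*} [Field k] [NumberField k]

/-- An element of a number field which is integral at all finite places is an algebraic integer. -/
lemma isIntegral_of_abv_le_one {x : k}
    (h : ∀ (v : Place k) (p : Nat.Primes), v.Over (some p) → v.abv x ≤ 1) : IsIntegral ℤ x := by
  have hP : (minpoly ℚ x).Monic := minpoly.monic (Algebra.IsIntegral.isIntegral x)
  -- At a place of `Qbar` over p all conjugates of x are integral, hence so are the coefficients of
  -- the product of the linear factors. Rational numbers integral at every p are integers.
  have hcoeff : ∀ (p : Nat.Primes) (i : ℕ), ratAbv (some p) ((minpoly ℚ x).coeff i) ≤ 1 := by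
    intro p i
    let y := basePoint (some p)
    have hy : y.Over (some p) := basePoint_over _
    let R : Subring Qbar := hy.valuation.integer
    have hlift : (minpoly ℚ x).map (algebraMap ℚ Qbar) ∈ liftsRing R.subtype := by
      rw [(IsAlgClosed.splits ((minpoly ℚ x).map (algebraMap ℚ Qbar))).eq_prod_roots_of_monic
        (hP.map _)]
      refine Subring.multiset_prod_mem _ _ fun f hf => ?_
      obtain ⟨z, hz, rfl⟩ := Multiset.mem_map.1 hf
      obtain ⟨σ, rfl⟩ := exists_ringHom_of_mem_roots _ x hz
      have hz' : σ x ∈ R := (hy.valuation_le_one_iff _).2 (h (comap σ y) p (hy.comap σ))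
      refine Subring.sub_mem _ ?_ ?_
      · exact (lifts_iff_liftsRing _ _).1 (X_mem_lifts _)
      · exact (lifts_iff_liftsRing _ _).1 (C'_mem_lifts ⟨⟨σ x, hz'⟩, rfl⟩)
    obtain ⟨r, hr⟩ := (lifts_iff_coeff_lifts _).1 ((lifts_iff_liftsRing _ _).2 hlift) i
    have h1 : y.abv (r : Qbar) ≤ 1 := (hy.valuation_le_one_iff _).1 r.2
    have h2 : (r : Qbar) = (((minpoly ℚ x).coeff i : ℚ) : Qbar) := by
      refine (show (r : Qbar) = R.subtype r from rfl).trans (hr.trans ?_)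
      rw [coeff_map, eq_ratCast]
    rwa [h2, hy] at h1
  have hlift : minpoly ℚ x ∈ lifts (Int.castRingHom ℚ) := by
    rw [lifts_iff_coeff_lifts]
    intro i
    exact exists_int_of_ratAbv_le_one fun p => hcoeff p i
  obtain ⟨Q, hQ, -, hQm⟩ := lifts_and_natDegree_eq_and_monic hlift hP
  refine ⟨Q, hQm, ?_⟩
  have h0 := minpoly.aeval ℚ x
  rwa [← hQ, aeval_def, eval₂_map, Subsingleton.elim ((algebraMap ℚ k).comp (Int.castRingHom ℚ))
    (algebraMap ℤ k)] at h0

/-- The maximal ideal attached to a finite place. -/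
noncomputable def center (v : Place k) {p : Nat.Primes} (hv : v.Over (some p)) :
    HeightOneSpectrum (𝓞 k) where
  asIdeal :=
    { carrier := {x | v.abv (x : k) < 1}
      zero_mem' := by simp
      add_mem' := fun {a b} ha hb => by
        have := hv.add_le_max (a : k) b
        exact (by simpa using this : v.abv ((a + b : 𝓞 k) : k) ≤ _).trans_lt (max_lt ha hb)
      smul_mem' := fun c x hx => by
        have hc := hv.abv_le_one_of_isIntegral (RingOfIntegers.isIntegral_coe c)
        have : v.abv ((c * x : 𝓞 k) : k) = v.abv (c : k) * v.abv (x : k) := by simp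
        exact this.trans_lt (mul_lt_one_of_nonneg_of_lt_one_right hc (v.abv.nonneg _) hx) }
  isPrime := by
    refine Ideal.isPrime_iff.2 ⟨?_, fun {a b} hab => ?_⟩
    · rw [Ne, Ideal.eq_top_iff_one]
      intro h
      have : v.abv ((1 : 𝓞 k) : k) < 1 := h
      simp at this
    · by_contra! h
      have ha : ¬ v.abv (a : k) < 1 := h.1
      have hb : ¬ v.abv (b : k) < 1 := h.2
      have hab' : v.abv ((a * b : 𝓞 k) : k) < 1 := hab
      rw [show ((a * b : 𝓞 k) : k) = (a : k) * b from map_mul _ _ _, map_mul] at hab'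
      exact hab'.not_ge (one_le_mul_of_one_le_of_one_le (not_lt.1 ha) (not_lt.1 hb))
  ne_bot := by
    intro h
    have hp : ((p.1 : 𝓞 k)) ∈ (⊥ : Ideal (𝓞 k)) := by
      rw [← h]
      change v.abv (((p.1 : ℕ) : 𝓞 k) : k) < 1
      have h1 := hv (p.1 : ℚ)
      rw [ratAbv_prime_self, Rat.cast_natCast] at h1
      simp only [map_natCast, h1]
      exact inv_lt_one_of_one_lt₀ (by exact_mod_cast p.2.one_lt)
    rw [Ideal.mem_bot, Nat.cast_eq_zero] at hp
    exact p.2.ne_zero hp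

section

variable {v : Place k} {p : Nat.Primes} (hv : v.Over (some p))

lemma abv_eq_one_of_notMem_center {x : 𝓞 k} (hx : x ∉ (v.center hv).asIdeal) :
    v.abv (x : k) = 1 :=
  le_antisymm (hv.abv_le_one_of_isIntegral (RingOfIntegers.isIntegral_coe x))
    (not_lt.1 fun h => hx h)

/-- Such an x is n / d with d outside the prime ideal, where d has absolute value 1. -/
lemma abv_le_one_of_valuation_le_one {x : k} (hx : (v.center hv).valuation k x ≤ 1) :
    v.abv x ≤ 1 := by
  obtain ⟨n, d, h⟩ := (v.center hv).exists_primeCompl_mul_eq_of_integer x hx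
  have h1 := congrArg v.abv h
  rw [map_mul, show v.abv (algebraMap (𝓞 k) k d) = 1 from
    abv_eq_one_of_notMem_center hv d.2, mul_one] at h1
  rw [h1]
  exact hv.abv_le_one_of_isIntegral (RingOfIntegers.isIntegral_coe n)

lemma abv_eq_one_of_valuation_eq_one {x : k} (hx : (v.center hv).valuation k x = 1) :
    v.abv x = 1 := by
  refine le_antisymm (abv_le_one_of_valuation_le_one hv hx.le) ?_
  have h := abv_le_one_of_valuation_le_one hv (x := x⁻¹) (by rw [map_inv₀, hx, inv_one])
  have h0 : x ≠ 0 := by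
    rintro rfl
    simp at hx
  rw [map_inv₀] at h
  exact (inv_le_one₀ (v.abv.pos h0)).1 h

lemma abv_lt_one_of_valuation_lt_one {x : k} (hx : (v.center hv).valuation k x < 1) :
    v.abv x < 1 := by
  obtain ⟨n, d, h⟩ := (v.center hv).exists_primeCompl_mul_eq_of_integer x hx.le
  have h1 := congrArg v.abv h
  have h2 := congrArg ((v.center hv).valuation k) h
  rw [map_mul, show v.abv (algebraMap (𝓞 k) k d) = 1 from
    abv_eq_one_of_notMem_center hv d.2, mul_one] at h1
  rw [map_mul, (HeightOneSpectrum.valuation_eq_one_iff_notMem (K := k) (v.center hv)).2 d.2, mul_one] at h2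
  rw [h2, HeightOneSpectrum.valuation_lt_one_iff_mem] at hx
  rw [h1]
  exact hx

/-- The prime ideal determines the open unit ball of the place. The ball contains only one rational
prime, so p = q, and normalized places over p with the same ball coincide. -/
lemma center_injective {w : Place k} {q : Nat.Primes} (hw : w.Over (some q))
    (h : v.center hv = w.center hw) : v = w := by
  have key : ∀ {v w : Place k} {p q : Nat.Primes} (hv : v.Over (some p)) (hw : w.Over (some q)),
      v.center hv = w.center hw → ∀ x : k, v.abv x < 1 → w.abv x < 1 := by
    intro v w p q hv hw h x hx
    refine abv_lt_one_of_valuation_lt_one hw ?_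
    rw [← h]
    by_contra! h1
    rcases h1.eq_or_lt with h2 | h2
    · exact hx.ne (abv_eq_one_of_valuation_eq_one hv h2.symm)
    · have h3 := abv_lt_one_of_valuation_lt_one hv (x := x⁻¹)
        (by rw [map_inv₀]; exact inv_lt_one_of_one_lt₀ h2)
      rw [map_inv₀] at h3
      have h0 : x ≠ 0 := by
        rintro rfl
        simp at h1
      exact hx.not_gt ((inv_lt_one₀ (v.abv.pos h0)).1 h3)
  have hpq : p = q := by
    by_contra hpq
    have h1 : v.abv ((p.1 : ℚ) : k) < 1 := by
      rw [hv, ratAbv_prime_self]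
      exact inv_lt_one_of_one_lt₀ (by exact_mod_cast p.2.one_lt)
    have h2 := key hv hw h _ h1
    rw [hw, ratAbv_prime_ne (Ne.symm hpq)] at h2
    exact lt_irrefl _ h2
  subst hpq
  exact eq_of_lt_one_imp hv hw (key hv hw h)

include hv in
/-- For every finite place there is an element which is a unit at all other finite places but not
at the given one. -/
lemma exists_abv_lt_one_and_eq_one :
    ∃ a : kˣ, v.abv (a : k) < 1 ∧
      ∀ (w : Place k) (q : Nat.Primes), w.Over (some q) → w ≠ v → w.abv (a : k) = 1 := by
  set I := (v.center hv).asIdeal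
  set h := Fintype.card (ClassGroup (𝓞 k))
  have hI0 : I ∈ nonZeroDivisors (Ideal (𝓞 k)) :=
    mem_nonZeroDivisors_of_ne_zero (v.center hv).ne_bot
  -- With h the class number, I^h is principal, and its generator lies in no prime ideal other than
  -- I.
  have h1 : ClassGroup.mk0 ⟨I ^ h, pow_mem hI0 h⟩ = 1 := by
    rw [show (⟨I ^ h, pow_mem hI0 h⟩ : nonZeroDivisors (Ideal (𝓞 k))) = ⟨I, hI0⟩ ^ h from rfl,
      map_pow, pow_card_eq_one]
  obtain ⟨a, ha⟩ := (ClassGroup.mk0_eq_one_iff (pow_mem hI0 h)).1 h1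
  have ha0 : a ≠ 0 := by
    rintro rfl
    refine pow_ne_zero h (v.center hv).ne_bot ?_
    exact ha.trans (Ideal.submodule_span_eq.trans Ideal.span_zero)
  have hak : (a : k) ≠ 0 := by simpa using ha0
  have hamem : a ∈ I ^ h := by rw [ha]; exact Submodule.mem_span_singleton_self a
  refine ⟨Units.mk0 (a : k) hak, ?_, fun w q hw hwv => ?_⟩
  · exact Ideal.pow_le_self Fintype.card_ne_zero hamem
  · refine abv_eq_one_of_notMem_center hw fun haw => hwv ?_
    have h2 : I ^ h ≤ (w.center hw).asIdeal := by
      rw [ha, Submodule.span_singleton_le_iff_mem]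
      exact haw
    have h3 : I ≤ (w.center hw).asIdeal := (w.center hw).isPrime.le_of_pow_le h2
    have h4 : I = (w.center hw).asIdeal :=
      (v.center hv).isMaximal.eq_of_le (w.center hw).isPrime.ne_top h3
    exact (center_injective hv hw (HeightOneSpectrum.ext h4)).symm

end

end Place

end

/-! ### The rank of the group of S-units. -/

section

open scoped NNReal

namespace Place

open Polynomial NumberField IsDedekindDomain

variable {k : Type*} [Field k] [NumberField k]

lemma exists_over_some {v : Place k} (hv : ¬ v.IsArchimedean) : ∃ p : Nat.Primes, v.Over (some p) := by
  obtain ⟨_ | p, h⟩ := v.exists_over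
  exacts [absurd h hv, ⟨p, h⟩]

/-- Surjectivity is `exists_comap_eq` at an archimedean place of `Qbar`: every archimedean place
comes from a complex embedding. -/
lemma natCard_isArchimedean :
    Nat.card {v : Place k // v.IsArchimedean} = Fintype.card (InfinitePlace k) := by
  have harch : ∀ w : InfinitePlace k, ∀ q : ℚ, w.1 (q : k) = Rat.AbsoluteValue.real q := by
    rintro ⟨_, σ, rfl⟩ q
    exact (congrArg norm (map_ratCast σ q)).trans (by simp)
  rw [← Nat.card_eq_fintype_card]
  refine (Nat.card_eq_of_bijective (fun w : InfinitePlace k =>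
    (⟨⟨w.1, Or.inl (harch w)⟩, harch w⟩ : {v : Place k // v.IsArchimedean})) ⟨?_, ?_⟩).symm
  · intro w w' h
    exact Subtype.ext (congrArg (fun v : {v : Place k // v.IsArchimedean} => v.1.abv) h)
  · rintro ⟨v, hv⟩
    obtain ⟨y, hy, hyσ⟩ := exists_over_none
      (IsAlgClosed.lift (R := ℚ) (S := Qbar) (M := ℂ)).toRingHom
    obtain ⟨σ, rfl⟩ := exists_comap_eq (q := none) hv hy
    refine ⟨InfinitePlace.mk
      ((IsAlgClosed.lift (R := ℚ) (S := Qbar) (M := ℂ)).toRingHom.comp σ), ?_⟩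
    exact Subtype.ext (ext_abv fun x => (hyσ (σ x)).symm)

/-- The order homomorphism of a finite place. -/
noncomputable def ord (v : Place k) (hv : ¬ v.IsArchimedean) : kˣ →* Multiplicative ℤ :=
  (v.center (exists_over_some hv).choose_spec).valuationOfNeZero

lemma abv_eq_one_of_ord_eq_one {v : Place k} (hv : ¬ v.IsArchimedean) {u : kˣ}
    (h : v.ord hv u = 1) : v.abv (u : k) = 1 := by
  refine abv_eq_one_of_valuation_eq_one (exists_over_some hv).choose_spec ?_
  rw [← HeightOneSpectrum.valuationOfNeZero_eq]
  exact congrArg _ h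

lemma ord_ne_one_of_abv_lt_one {v : Place k} (hv : ¬ v.IsArchimedean) {u : kˣ}
    (h : v.abv (u : k) < 1) : v.ord hv u ≠ 1 :=
  fun h1 => h.ne (abv_eq_one_of_ord_eq_one hv h1)

lemma abv_unit_eq_one {v : Place k} (hv : ¬ v.IsArchimedean) (u : (𝓞 k)ˣ) :
    v.abv ((u : 𝓞 k) : k) = 1 := by
  obtain ⟨p, hp⟩ := exists_over_some hv
  have h (u : (𝓞 k)ˣ) := hp.abv_le_one_of_isIntegral (RingOfIntegers.isIntegral_coe (u : 𝓞 k))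
  refine le_antisymm (h u) ?_
  have h1 : v.abv ((u : 𝓞 k) : k) * v.abv ((↑u⁻¹ : 𝓞 k) : k) = 1 := by
    rw [← map_mul, ← map_mul, Units.mul_inv, map_one, map_one]
  rw [← h1]
  exact mul_le_of_le_one_right (v.abv.nonneg _) (h u⁻¹)

lemma ord_unit (v : Place k) (hv : ¬ v.IsArchimedean) (u : (𝓞 k)ˣ) :
    v.ord hv (Units.map (algebraMap (𝓞 k) k : 𝓞 k →* k) u) = 1 :=
  HeightOneSpectrum.valuation_of_unit_eq _ _

lemma ord_eq_one_of_abv_eq_one {v : Place k} (hv : ¬ v.IsArchimedean) {u : kˣ}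
    (h : v.abv (u : k) = 1) : v.ord hv u = 1 := by
  by_contra hne
  have hp := (exists_over_some hv).choose_spec
  have key : ∀ u : kˣ, v.abv (u : k) = 1 → ¬ (v.center hp).valuation k (u : k) < 1 :=
    fun u hu h1 => hu.not_lt (abv_lt_one_of_valuation_lt_one hp h1)
  have h1 := key u h
  have h2 := key u⁻¹ (by simp [h])
  rw [Units.val_inv_eq_inv_val, map_inv₀, inv_lt_one₀ (by simp [zero_lt_iff])] at h2
  have h3 : (v.center hp).valuation k (u : k) = 1 := le_antisymm (not_lt.1 h2) (not_lt.1 h1)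
  rw [← HeightOneSpectrum.valuationOfNeZero_eq, ← WithZero.coe_one, WithZero.coe_inj] at h3
  exact hne h3

end Place

open Place NumberField

variable {k : Type*} [Field k] [NumberField k] (S : Finset (Place k))

/-- The finite places in `S`. -/
abbrev FinitePlacesIn : Type _ := {v : Place k // v ∈ S ∧ ¬ v.IsArchimedean}

noncomputable instance : Fintype (FinitePlacesIn S) :=
  haveI : Finite (FinitePlacesIn S) := (S.finite_toSet.subset fun _ h => h.1).to_subtype
  Fintype.ofFinite _

/-- The orders of `S`-units at the finite places in `S`. -/
noncomputable def sUnitsOrd : Additive (sUnits S) →ₗ[ℤ] (FinitePlacesIn S → ℤ) :=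
  LinearMap.pi fun v =>
    (AddMonoidHom.toMultiplicativeRight.symm ((v.1.ord v.2.2).comp (sUnits S).subtype)).toIntLinearMap

variable {S} (hS : ∀ v : Place k, v.IsArchimedean → v ∈ S)

/-- The units of the ring of integers as `S`-units. -/
noncomputable def unitsToSUnits : Additive (𝓞 k)ˣ →ₗ[ℤ] Additive (sUnits S) :=
  (MonoidHom.toAdditive ((Units.map (algebraMap (𝓞 k) k : 𝓞 k →* k)).codRestrict (sUnits S)
    fun u v hv => abv_unit_eq_one (fun h => hv (hS v h)) u)).toIntLinearMap

lemma unitsToSUnits_injective : Function.Injective (unitsToSUnits hS) := by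
  intro u u' h
  have h1 : Units.map (algebraMap (𝓞 k) k : 𝓞 k →* k) u.toMul =
      Units.map (algebraMap (𝓞 k) k : 𝓞 k →* k) u'.toMul :=
    congrArg (fun x : Additive (sUnits S) => (x.toMul : kˣ)) h
  exact Units.map_injective (RingOfIntegers.coe_injective) h1

/-- An S-unit of order zero at the finite places of S has absolute value 1 at every finite place, so
it and its inverse are integral. -/
lemma range_unitsToSUnits : LinearMap.range (unitsToSUnits hS) = LinearMap.ker (sUnitsOrd S) := by
  ext u
  rw [LinearMap.mem_range, LinearMap.mem_ker]
  constructor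
  · rintro ⟨u, rfl⟩
    funext v
    exact congrArg Multiplicative.toAdd (ord_unit v.1 v.2.2 u.toMul)
  · intro h
    have h1 : ∀ v : Place k, ¬ v.IsArchimedean → v.abv ((u.toMul : kˣ) : k) = 1 := by
      intro v hv
      by_cases hvS : v ∈ S
      · exact abv_eq_one_of_ord_eq_one hv (congrFun h ⟨v, hvS, hv⟩)
      · exact u.toMul.2 v hvS
    have hint : ∀ x : k, (∀ v : Place k, ¬ v.IsArchimedean → v.abv x = 1) → IsIntegral ℤ x :=
      fun x hx => isIntegral_of_abv_le_one fun v p hp =>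
        (hx v fun h => by simpa using Over.unique (q := none) h hp).le
    let a : 𝓞 k := ⟨((u.toMul : kˣ) : k), hint _ h1⟩
    let b : 𝓞 k := ⟨((u.toMul : kˣ) : k)⁻¹, hint _ fun v hv => by rw [map_inv₀, h1 v hv, inv_one]⟩
    have hab : a * b = 1 := RingOfIntegers.ext (mul_inv_cancel₀ (u.toMul : kˣ).ne_zero)
    refine ⟨Additive.ofMul ⟨a, b, hab, by rw [mul_comm, hab]⟩, ?_⟩
    exact congrArg Additive.ofMul (Subtype.ext (Units.ext rfl))

include hS in
lemma finite_sUnits : Module.Finite ℤ (Additive (sUnits S)) := by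
  rw [Module.finite_def]
  refine Submodule.fg_of_fg_map_of_fg_inf_ker (sUnitsOrd S) (IsNoetherian.noetherian _) ?_
  rw [inf_of_le_right le_top, ← range_unitsToSUnits hS, ← Module.Finite.iff_fg]
  infer_instance

include hS in
-- For each finite v in S, `exists_abv_lt_one_and_eq_one` yields an S-unit whose order vector is a
-- nonzero multiple of the basis vector at v. The image need not be everything, but it has full
-- rank.
lemma finrank_range_sUnitsOrd :
    Module.finrank ℤ (LinearMap.range (sUnitsOrd S)) = Fintype.card (FinitePlacesIn S) := by
  classical
  refine le_antisymm ((Submodule.finrank_le _).trans (Module.finrank_fintype_fun_eq_card ℤ).le) ?_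
  have h : ∀ v : FinitePlacesIn S, ∃ n : ℤ, n ≠ 0 ∧
      Pi.single v n ∈ LinearMap.range (sUnitsOrd S) := by
    intro v
    obtain ⟨p, hp⟩ := exists_over_some v.2.2
    obtain ⟨a, ha1, ha2⟩ := exists_abv_lt_one_and_eq_one hp
    have ha2' : ∀ w : Place k, ¬ w.IsArchimedean → w ≠ v.1 → w.abv (a : k) = 1 := fun w hw hne =>
      (exists_over_some hw).elim fun q hq => ha2 w q hq hne
    have haS : a ∈ sUnits S := fun w hw =>
      ha2' w (fun h => hw (hS w h)) (fun h => hw (h ▸ v.2.1))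
    refine ⟨sUnitsOrd S (Additive.ofMul ⟨a, haS⟩) v, ?_, Additive.ofMul ⟨a, haS⟩, ?_⟩
    · exact fun h0 => ord_ne_one_of_abv_lt_one v.2.2 ha1 h0
    · funext w
      by_cases hwv : w = v
      · subst hwv
        rw [Pi.single_eq_same]
      · rw [Pi.single_eq_of_ne hwv]
        exact ord_eq_one_of_abv_eq_one w.2.2 (ha2' w.1 w.2.2 fun h => hwv (Subtype.ext h))
  choose n hn hmem using h
  have hli : LinearIndependent ℤ fun v : FinitePlacesIn S =>
      (⟨Pi.single v (n v), hmem v⟩ : LinearMap.range (sUnitsOrd S)) := by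
    refine LinearIndependent.of_comp (LinearMap.range (sUnitsOrd S)).subtype ?_
    rw [Fintype.linearIndependent_iff]
    intro g hg v
    have := congrFun hg v
    simpa [Finset.sum_apply, Pi.single_apply, hn v] using this
  exact hli.fintype_card_le_finrank

include hS in
-- Kernel and image of the order map contribute the rank of the unit group, the number of
-- archimedean places minus one, and the number of finite places in S.
theorem finrank_sUnits : Module.finrank ℤ (Additive (sUnits S)) = S.card - 1 := by
  classical
  have := finite_sUnits hS
  rw [← Submodule.finrank_quotient_add_finrank (LinearMap.ker (sUnitsOrd S)),
    (sUnitsOrd S).quotKerEquivRange.finrank_eq, finrank_range_sUnitsOrd hS,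
    ← range_unitsToSUnits hS, LinearMap.finrank_range_of_inj (unitsToSUnits_injective hS),
    NumberField.Units.finrank_eq, NumberField.Units.rank, ← natCard_isArchimedean]
  have h1 : (S.filter fun v => v.IsArchimedean).card = Nat.card {v : Place k // v.IsArchimedean} := by
    refine (Nat.subtype_card _ fun v => ?_).symm
    rw [Finset.mem_filter]
    exact ⟨fun h => h.2, fun h => ⟨hS v h, h⟩⟩
  have h2 : (S.filter fun v => ¬ v.IsArchimedean).card = Fintype.card (FinitePlacesIn S) := by
    rw [Fintype.card_eq_nat_card]
    exact (Nat.subtype_card _ fun v => Finset.mem_filter).symm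
  -- Having an archimedean place makes the truncated subtraction harmless.
  have h3 : 0 < Nat.card {v : Place k // v.IsArchimedean} := by
    rw [natCard_isArchimedean]
    exact Fintype.card_pos
  have := S.card_filter_add_card_filter_not (fun v => v.IsArchimedean)
  omega

end

/-! ### The product formula, and S-units modulo torsion. -/

section

open scoped NNReal

namespace Place

open NumberField

lemma log_ratAbv_mul (q : Option Nat.Primes) {a b : ℚ} (ha : a ≠ 0) (hb : b ≠ 0) :
    Real.log (ratAbv q (a * b)) = Real.log (ratAbv q a) + Real.log (ratAbv q b) := by
  rw [map_mul, Real.log_mul ((ratAbv q).ne_zero ha) ((ratAbv q).ne_zero hb)]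

/-- The product formula for natural numbers. -/
lemma exists_sum_log_ratAbv_natCast_eq_zero (n : ℕ) : n ≠ 0 → ∃ Q₀ : Finset (Option Nat.Primes),
    ∀ Q, Q₀ ⊆ Q → ∑ q ∈ Q, Real.log (ratAbv q (n : ℚ)) = 0 := by
  classical
  induction n using Nat.recOnMul with
  | zero => exact fun h => absurd rfl h
  | one => exact fun _ => ⟨∅, fun Q _ => by simp⟩
  | prime p hp =>
    intro _
    -- Only ∞ and p contribute, with log p and -log p. Allowing every larger Q lets the sets for two
    -- factors be merged.
    refine ⟨{none, some ⟨p, hp⟩}, fun Q hQ => ?_⟩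
    rw [← Finset.sum_subset hQ, Finset.sum_pair (by simp)]
    · have h1 := ratAbv_prime_self ⟨p, hp⟩
      simp only at h1
      rw [h1, Real.log_inv]
      simp [ratAbv]
    · rintro (_ | q) _ hq
      · simp at hq
      · have : q ≠ ⟨p, hp⟩ := fun h => hq (by simp [h])
        have h1 := ratAbv_prime_ne this
        simp only at h1
        rw [h1, Real.log_one]
  | mul a b ha hb =>
    intro hab
    have ha0 : a ≠ 0 := left_ne_zero_of_mul hab
    have hb0 : b ≠ 0 := right_ne_zero_of_mul hab
    obtain ⟨A, hA⟩ := ha ha0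
    obtain ⟨B, hB⟩ := hb hb0
    refine ⟨A ∪ B, fun Q hQ => ?_⟩
    rw [Nat.cast_mul, Finset.sum_congr rfl fun q _ =>
      log_ratAbv_mul q (Nat.cast_ne_zero.2 ha0) (Nat.cast_ne_zero.2 hb0),
      Finset.sum_add_distrib, hA Q (Finset.union_subset_left hQ),
      hB Q (Finset.union_subset_right hQ), add_zero]

/-- The product formula for rational numbers. -/
lemma exists_sum_log_ratAbv_eq_zero {r : ℚ} (hr : r ≠ 0) : ∃ Q₀ : Finset (Option Nat.Primes),
    ∀ Q, Q₀ ⊆ Q → ∑ q ∈ Q, Real.log (ratAbv q r) = 0 := by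
  classical
  have hnum : r.num.natAbs ≠ 0 := by simpa using hr
  obtain ⟨A, hA⟩ := exists_sum_log_ratAbv_natCast_eq_zero _ hnum
  obtain ⟨B, hB⟩ := exists_sum_log_ratAbv_natCast_eq_zero _ r.den_ne_zero
  refine ⟨A ∪ B, fun Q hQ => ?_⟩
  have key : ∀ q, Real.log (ratAbv q r) =
      Real.log (ratAbv q (r.num.natAbs : ℚ)) - Real.log (ratAbv q (r.den : ℚ)) := by
    intro q
    rw [AbsoluteValue.apply_natAbs_eq, ← Real.log_div, ← map_div₀, Rat.num_div_den]
    · exact (ratAbv q).ne_zero (by simpa using hr)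
    · exact (ratAbv q).ne_zero (by simp)
  rw [Finset.sum_congr rfl fun q _ => key q, Finset.sum_sub_distrib,
    hA Q (Finset.union_subset_left hQ), hB Q (Finset.union_subset_right hQ), sub_zero]

variable {k : Type*} [Field k] [NumberField k]

/-- The norm is the product of the conjugates in `Qbar`; grouping the embeddings by the place they
induce from y, each v occurs as often as its local degree. -/
lemma sum_localDegree_mul_log {q : Option Nat.Primes} {t : Finset (Place k)}
    (ht : ∀ v, v ∈ t ↔ v.Over q) {x : k} (hx : x ≠ 0) :
    ∑ v ∈ t, (v.localDegree : ℝ) * Real.log (v.abv x) =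
      Real.log (ratAbv q (Algebra.norm ℚ x)) := by
  classical
  let y := basePoint q
  have hy : y.Over q := basePoint_over q
  have hnorm : ((Algebra.norm ℚ x : ℚ) : Qbar) = ∏ σ : k →+* Qbar, σ x := by
    have := Algebra.norm_eq_prod_embeddings ℚ Qbar x
    rw [eq_ratCast] at this
    rw [this]
    exact Fintype.prod_equiv (RingHom.equivRatAlgHom k Qbar).symm _ _ fun _ => rfl
  rw [← hy, hnorm, map_prod, Real.log_prod fun σ _ => y.abv.ne_zero ((map_ne_zero σ).2 hx),
    ← Finset.sum_fiberwise_of_maps_to (s := Finset.univ) (t := t)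
      (g := fun σ : k →+* Qbar => comap σ y) fun σ _ => (ht _).2 (hy.comap σ)]
  refine Finset.sum_congr rfl fun v hv => ?_
  rw [Finset.sum_congr rfl (g := fun _ => Real.log (v.abv x)), Finset.sum_const, nsmul_eq_mul,
    ← natCard_comap_eq_localDegree ((ht v).1 hv) hy]
  · congr 2
    exact Nat.subtype_card _ (by simp)
  · rintro σ hσ
    rw [Finset.mem_filter] at hσ
    rw [← hσ.2, comap_abv_apply]

end Place

open Place

section

variable {k : Type*} [Field k] [NumberField k]

/-- The product formula for `S`-units. -/
theorem sum_localDegree_mul_log_sUnits {S : Finset (Place k)} (u : sUnits S) :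
    ∑ v ∈ S, (v.localDegree : ℝ) * Real.log (v.abv ((u : kˣ) : k)) = 0 := by
  classical
  have hx : ((u : kˣ) : k) ≠ 0 := (u : kˣ).ne_zero
  obtain ⟨Q₀, hQ₀⟩ := exists_sum_log_ratAbv_eq_zero ((Algebra.norm_ne_zero_iff (R := ℚ)).2 hx)
  choose b hb using fun v : Place k => v.exists_over
  let t (q : Option Nat.Primes) : Finset (Place k) := (finite_over q).toFinset
  have ht : ∀ q v, v ∈ t q ↔ v.Over q := fun q v => (finite_over q).mem_toFinset
  -- Q contains the places of ℚ below S, so the places above Q include S; the additional ones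
  -- contribute log 1 = 0.
  let Q := Q₀ ∪ S.image b
  have hsub : S ⊆ Q.biUnion t := fun v hv => Finset.mem_biUnion.2
    ⟨b v, Finset.mem_union_right _ (Finset.mem_image_of_mem b hv), (ht _ _).2 (hb v)⟩
  rw [Finset.sum_subset hsub, Finset.sum_biUnion]
  · rw [Finset.sum_congr rfl fun q _ => sum_localDegree_mul_log (ht q) hx]
    exact hQ₀ Q Finset.subset_union_left
  · intro q _ r _ hqr
    exact Finset.disjoint_left.2 fun v hq hr => hqr (((ht _ _).1 hq).unique ((ht _ _).1 hr))
  · intro v _ hv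
    rw [u.2 v hv, Real.log_one, mul_zero]

lemma finrank_sUnits_quotient {S : Finset (Place k)}
    (hS : ∀ v : Place k, v.IsArchimedean → v ∈ S) :
    Module.finrank ℤ (Additive (sUnits S ⧸ CommGroup.torsion (sUnits S))) = S.card - 1 := by
  rw [← finrank_sUnits hS]
  simpa using! finrank_quotient_torsion_eq (M := Additive (sUnits S))

lemma finite_sUnits_quotient {S : Finset (Place k)}
    (hS : ∀ v : Place k, v.IsArchimedean → v ∈ S) :
    Module.Finite ℤ (Additive (sUnits S ⧸ CommGroup.torsion (sUnits S))) := by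
  have := finite_sUnits hS
  exact Module.Finite.of_surjective
    (MonoidHom.toAdditive (QuotientGroup.mk' (CommGroup.torsion (sUnits S)))).toIntLinearMap
    (by exact QuotientGroup.mk'_surjective (CommGroup.torsion (sUnits S)))

variable [Algebra k Qbar]

/-- The homomorphism from the `S`-units to the group of algebraic numbers modulo torsion. -/
noncomputable def sUnitsToG (S : Finset (Place k)) : sUnits S →* GroupG :=
  ((QuotientGroup.mk' (CommGroup.torsion Qbarˣ)).comp
    (Units.map (algebraMap k Qbar : k →* Qbar))).comp (sUnits S).subtype

lemma range_sUnitsToG (S : Finset (Place k)) : (sUnitsToG S).range = sUnitsImage S := by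
  rw [sUnitsToG, MonoidHom.range_comp, Subgroup.range_subtype, sUnitsImage]

lemma ker_sUnitsToG (S : Finset (Place k)) :
    (sUnitsToG S).ker = CommGroup.torsion (sUnits S) := by
  ext u
  rw [MonoidHom.mem_ker]
  change (QuotientGroup.mk (Units.map (algebraMap k Qbar : k →* Qbar) u.1) : GroupG) = 1 ↔
    IsOfFinOrder u
  rw [QuotientGroup.eq_one_iff]
  change IsOfFinOrder (((Units.map (algebraMap k Qbar : k →* Qbar)).comp (sUnits S).subtype) u) ↔ _
  exact ((Units.map_injective (algebraMap k Qbar).injective).comp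
    Subtype.val_injective).isOfFinOrder_iff

/-- The `S`-units modulo torsion are the image of the `S`-units in `𝒢`. -/
noncomputable def sUnitsModTorsionEquiv (S : Finset (Place k)) :
    (sUnits S ⧸ CommGroup.torsion (sUnits S)) ≃* sUnitsImage S :=
  (QuotientGroup.quotientMulEquivOfEq (ker_sUnitsToG S).symm).trans
    ((QuotientGroup.quotientKerEquivRange (sUnitsToG S)).trans
      (MulEquiv.subgroupCongr (range_sUnitsToG S)))

lemma coe_sUnitsModTorsionEquiv_mk (S : Finset (Place k)) (u : sUnits S) :
    (sUnitsModTorsionEquiv S (QuotientGroup.mk u) : GroupG) = sUnitsToG S u := rfl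

lemma logFun_sUnitsToG {S : Finset (Place k)} (u : sUnits S) (y : Place Qbar) :
    logFun (sUnitsToG S u) y = Real.log ((y.restrict k).abv ((u : kˣ) : k)) := rfl

end

end

/-! ### Maximal minors, the integral and the regulator. -/

section

section Determinants

open Matrix

/-- If the rows of an `N × (N + 1)` matrix sum to zero, then its maximal minors agree up to sign. -/
lemma abs_det_submatrix_eq_succAbove_zero {N : ℕ} (M : Matrix (Fin N) (Fin (N + 1)) ℝ)
    (hM : ∀ i, ∑ j, M i j = 0) {c : Fin N → Fin (N + 1)} (hc : Function.Injective c) :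
    |(M.submatrix id c).det| = |(M.submatrix id (Fin.succAbove 0)).det| := by
  -- N values cannot cover N + 1 columns, so c omits some j and equals `j.succAbove` up to a
  -- permutation.
  obtain ⟨j, hj⟩ : ∃ j, ∀ n, c n ≠ j := by
    by_contra! h
    have := Fintype.card_le_of_surjective c h
    simp at this
  choose π hπ using fun n => Fin.exists_succAbove_eq (hj n)
  have hπi : Function.Injective π := fun a b hab => hc (by rw [← hπ, ← hπ, hab])
  let p : Equiv.Perm (Fin N) := Equiv.ofBijective π (Finite.injective_iff_bijective.1 hπi)
  have h1 : M.submatrix id c = (M.submatrix id j.succAbove).submatrix id p := by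
    ext a b
    simp [p, hπ]
  rw [h1, det_permute', submatrix_succAbove_det_eq_negOnePow_submatrix_succAbove_det' M hM j 0]
  rcases Int.units_eq_one_or (Equiv.Perm.sign p) with h | h <;>
  rcases Int.units_eq_one_or (Int.negOnePow ((j : ℕ) - ((0 : Fin (N + 1)) : ℕ))) with h' | h' <;>
  rw [h, h'] <;> simp

lemma abs_det_submatrix_eq {N : ℕ} {σ : Type*} [Fintype σ] (hσ : Fintype.card σ = N + 1)
    (M : Matrix (Fin N) σ ℝ) (hM : ∀ i, ∑ j, M i j = 0) {c c' : Fin N → σ}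
    (hc : Function.Injective c) (hc' : Function.Injective c') :
    |(M.submatrix id c).det| = |(M.submatrix id c').det| := by
  let e : σ ≃ Fin (N + 1) := Fintype.equivFinOfCardEq hσ
  have key : ∀ c : Fin N → σ, M.submatrix id c =
      (M.submatrix id e.symm).submatrix id (e ∘ c) := fun c => by ext; simp
  have hM' : ∀ i, ∑ j, M.submatrix id e.symm i j = 0 := fun i => by
    rw [← hM i]
    exact Fintype.sum_equiv e.symm _ _ fun _ => rfl
  rw [key c, key c', abs_det_submatrix_eq_succAbove_zero _ hM' (e.injective.comp hc),
    abs_det_submatrix_eq_succAbove_zero _ hM' (e.injective.comp hc')]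

/-- The sum of the absolute values of all maximal minors, over ordered choices of columns. -/
lemma sum_abs_det_submatrix {N : ℕ} {σ : Type*} [Fintype σ] (hσ : Fintype.card σ = N + 1)
    (M : Matrix (Fin N) σ ℝ) (hM : ∀ i, ∑ j, M i j = 0) {c' : Fin N → σ}
    (hc' : Function.Injective c') :
    ∑ c : Fin N → σ, |(M.submatrix id c).det| = ((N + 1)! : ℝ) * |(M.submatrix id c').det| := by
  classical
  have h1 : ∀ c : Fin N → σ, |(M.submatrix id c).det| =
      if Function.Injective c then |(M.submatrix id c').det| else 0 := by
    intro c
    split_ifs with hc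
    · exact abs_det_submatrix_eq hσ M hM hc hc'
    · simp only [Function.Injective, not_forall] at hc
      obtain ⟨a, b, hab, hne⟩ := hc
      rw [det_zero_of_column_eq hne fun i => by simp [hab], abs_zero]
  rw [Finset.sum_congr rfl fun c _ => h1 c, ← Finset.sum_filter, Finset.sum_const, nsmul_eq_mul]
  congr 2
  rw [← Fintype.card_subtype,
    Fintype.card_congr (Equiv.subtypeInjectiveEquivEmbedding (Fin N) σ),
    Fintype.card_embedding_eq, hσ, Fintype.card_fin]
  -- The number of injections is (N + 1)! / 1!.
  have := Nat.factorial_mul_descFactorial (n := N + 1) (k := N) (Nat.le_succ N)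
  simpa using this

/-- The absolute value of a determinant of additive functions at a basis of a `ℤ`-module does not
depend on the basis. -/
lemma abs_det_basis_eq {ι M : Type*} [Fintype ι] [DecidableEq ι] [AddCommGroup M]
    (B B' : Module.Basis ι ℤ M) (L : ι → M →+ ℝ) :
    |(Matrix.of fun l n => L n (B l)).det| = |(Matrix.of fun l n => L n (B' l)).det| := by
  have h1 : (Matrix.of fun l n => L n (B l)) =
      ((B'.toMatrix B).map (Int.cast : ℤ → ℝ))ᵀ * Matrix.of fun l n => L n (B' l) := by
    ext l n
    rw [mul_apply, of_apply]
    conv_lhs => rw [← B'.sum_repr (B l), map_sum]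
    refine Finset.sum_congr rfl fun m _ => ?_
    rw [map_zsmul, zsmul_eq_mul]
    rfl
  have h2 : IsUnit (B'.toMatrix B).det := B'.isUnit_det B
  rw [h1, det_mul, det_transpose, abs_mul]
  have h3 : ((B'.toMatrix B).map (Int.cast : ℤ → ℝ)).det = ((B'.toMatrix B).det : ℝ) :=
    (Int.cast_det _).symm
  rw [h3]
  rcases Int.isUnit_iff.1 h2 with h | h <;> simp [h]

end Determinants

open Place

variable {k : Type*} [Field k] [NumberField k]

section Integral

variable [Algebra k Qbar]

/-- If some y_n lies over a place outside S, column n is zero. Otherwise the integrand is constant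
on the box of fibers containing y, whose mass is a product of local degrees over [k : ℚ]^N;
multilinearity moves the degrees into the columns. -/
lemma integral_abs_det_log {S : Finset (Place k)} {N : ℕ} (u : Fin N → sUnits S) :
    ∫ y : Fin N → Place Qbar,
      |(Matrix.of fun l n => Real.log (((y n).restrict k).abv ((u l : kˣ) : k))).det|
        ∂(Measure.pi fun _ => placeMeasure) =
    ((Module.finrank ℚ k : ℝ) ^ N)⁻¹ * ∑ c : Fin N → S,
      |(Matrix.of fun l n => ((c n).1.localDegree : ℝ) *
        Real.log ((c n).1.abv ((u l : kˣ) : k))).det| := by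
  classical
  let a (c : Fin N → S) : ℝ :=
    |(Matrix.of fun l n => Real.log ((c n).1.abv ((u l : kˣ) : k))).det|
  let E (c : Fin N → S) : Set (Fin N → Place Qbar) := Set.univ.pi fun n => (c n).1.fiber
  have hE : ∀ c, MeasurableSet (E c) := fun c =>
    MeasurableSet.univ_pi fun n => (isOpen_fiber (c n).1).measurableSet
  have hμ : ∀ c, (Measure.pi fun _ : Fin N => placeMeasure) (E c) =
      ∏ n, ((c n).1.localDegree : ℝ≥0∞) / (Module.finrank ℚ k : ℝ≥0∞) := fun c => by
    rw [Measure.pi_pi]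
    exact Finset.prod_congr rfl fun n _ => placeMeasure_fiber _
  have hk : (Module.finrank ℚ k : ℝ≥0∞) ≠ 0 := by
    exact_mod_cast (Module.finrank_pos (R := ℚ) (M := k)).ne'
  have hfin : ∀ c, (Measure.pi fun _ : Fin N => placeMeasure) (E c) ≠ ∞ := fun c => by
    rw [hμ]
    exact ENNReal.prod_ne_top fun n _ => ENNReal.div_ne_top (by simp) hk
  have hsum : ∀ y : Fin N → Place Qbar,
      |(Matrix.of fun l n => Real.log (((y n).restrict k).abv ((u l : kˣ) : k))).det| =
        ∑ c : Fin N → S, (E c).indicator (fun _ => a c) y := by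
    intro y
    by_cases hy : ∀ n, (y n).restrict k ∈ S
    · let c₀ : Fin N → S := fun n => ⟨(y n).restrict k, hy n⟩
      rw [Finset.sum_eq_single c₀]
      · rw [Set.indicator_of_mem]
        exact fun n _ => rfl
      · intro c _ hc
        refine Set.indicator_of_notMem (fun h => hc ?_) _
        funext n
        exact Subtype.ext (h n trivial).symm
      · simp
    · push Not at hy
      obtain ⟨n, hn⟩ := hy
      rw [Matrix.det_eq_zero_of_column_eq_zero n fun l => by
        rw [Matrix.of_apply, (u l).2 _ hn, Real.log_one], abs_zero, Finset.sum_eq_zero]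
      intro c _
      refine Set.indicator_of_notMem (fun h => hn ?_) _
      rw [show (y n).restrict k = (c n).1 from h n trivial]
      exact (c n).2
  simp_rw [hsum]
  rw [integral_finsetSum _ fun c _ =>
    (integrable_indicator_iff (hE c)).2 (integrableOn_const (hfin c)), Finset.mul_sum]
  refine Finset.sum_congr rfl fun c _ => ?_
  rw [integral_indicator_const _ (hE c), measureReal_def, hμ, ENNReal.toReal_prod, smul_eq_mul]
  have hdet : (Matrix.of fun l n => ((c n).1.localDegree : ℝ) *
      Real.log ((c n).1.abv ((u l : kˣ) : k))).det = (∏ n, ((c n).1.localDegree : ℝ)) *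
        (Matrix.of fun l n => Real.log ((c n).1.abv ((u l : kˣ) : k))).det :=
    Matrix.det_mul_row _ _
  rw [hdet, abs_mul, abs_of_nonneg (Finset.prod_nonneg fun _ _ => Nat.cast_nonneg _), ← mul_assoc]
  congr 1
  simp [ENNReal.toReal_div, div_eq_inv_mul, Finset.prod_mul_distrib]

end Integral

/-- The function `log ‖·‖_v` on the `S`-units modulo torsion. -/
noncomputable def sUnitsLog {S : Finset (Place k)} (v : Place k) :
    Additive (sUnits S ⧸ CommGroup.torsion (sUnits S)) →+ ℝ :=
  MonoidHom.toAdditiveLeft (QuotientGroup.lift (CommGroup.torsion (sUnits S))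
    ((logAbv v.abv).comp (sUnits S).subtype) fun u hu => by
      have h : v.abv ((u : kˣ) : k) = 1 :=
        abv_eq_one_of_isOfFinOrder v.abv ((sUnits S).subtype.isOfFinOrder hu)
      simp [logAbv, h])

/-- This rules out the default value 0 in `sRegulator`. -/
lemma nonempty_regulatorData {S : Finset (Place k)} (hS : ∀ v : Place k, v.IsArchimedean → v ∈ S)
    (hne : S.Nonempty) : Nonempty (RegulatorData S) := by
  classical
  obtain ⟨v₀, hv₀⟩ := hne
  have := finite_sUnits_quotient hS
  have hcard : Fintype.card {v : Place k // v ∈ S.erase v₀} = S.card - 1 := by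
    rw [Fintype.card_coe, Finset.card_erase_of_mem hv₀]
  let b := (Module.finBasisOfFinrankEq ℤ (Additive (sUnits S ⧸ CommGroup.torsion (sUnits S)))
    (finrank_sUnits_quotient hS)).reindex ((Fintype.equivFinOfCardEq hcard).symm.trans
      (Equiv.subtypeEquivRight fun v => by rw [Finset.mem_erase, and_comm]))
  choose η hη using fun i => QuotientGroup.mk_surjective (b i).toMul
  exact ⟨⟨v₀, hv₀, η, b, fun i => by rw [hη]; rfl⟩⟩

/-- c enumerates the places of S other than the omitted one, and passing from u to the fundamental
system of D multiplies the determinant by ±1. The instances are arbitrary so that the result matches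
those inside `sRegulator`. -/
lemma abs_det_eq_of_regulatorData {S : Finset (Place k)} {N : ℕ} (hN : S.card = N + 1)
    (u : Fin N → sUnits S)
    (B : Module.Basis (Fin N) ℤ (Additive (sUnits S ⧸ CommGroup.torsion (sUnits S))))
    (hB : ∀ l, B l = Additive.ofMul (QuotientGroup.mk (u l))) (D : RegulatorData S)
    {_ : Fintype {v : Place k // v ∈ S ∧ v ≠ D.v₀}}
    {_ : DecidableEq {v : Place k // v ∈ S ∧ v ≠ D.v₀}} :
    ∃ c : Fin N → S, Function.Injective c ∧
      |(Matrix.of fun l n => ((c n).1.localDegree : ℝ) *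
        Real.log ((c n).1.abv ((u l : kˣ) : k))).det| =
      |(Matrix.of fun l v : {v : Place k // v ∈ S ∧ v ≠ D.v₀} =>
        (v.1.localDegree : ℝ) * Real.log (v.1.abv ((D.η l : kˣ) : k))).det| := by
  obtain ⟨b, hb⟩ := D.fundamental
  have hcard : Fintype.card {v : Place k // v ∈ S ∧ v ≠ D.v₀} = N := by
    classical
    rw [Fintype.card_eq_nat_card, Nat.subtype_card (S.erase D.v₀) fun v => by
      rw [Finset.mem_erase, and_comm], Finset.card_erase_of_mem D.mem, hN, Nat.add_sub_cancel]
  let e := (Fintype.equivFinOfCardEq hcard).symm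
  refine ⟨fun n => ⟨(e n).1, (e n).2.1⟩, fun a a' haa => e.injective (Subtype.ext
    (congrArg (fun x : S => (x : Place k)) haa)), ?_⟩
  let L (n : Fin N) : Additive (sUnits S ⧸ CommGroup.torsion (sUnits S)) →+ ℝ :=
    (AddMonoidHom.mulLeft ((e n).1.localDegree : ℝ)).comp (sUnitsLog (e n).1)
  have h1 := abs_det_basis_eq B (b.reindex e.symm) L
  have h2 : (Matrix.of fun l n => L n (B l)) = Matrix.of fun l n =>
      ((e n).1.localDegree : ℝ) * Real.log ((e n).1.abv ((u l : kˣ) : k)) := by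
    ext l n
    rw [Matrix.of_apply, hB]
    rfl
  have h3 : (Matrix.of fun l n => L n (b.reindex e.symm l)) =
      (Matrix.of fun l v : {v : Place k // v ∈ S ∧ v ≠ D.v₀} =>
      (v.1.localDegree : ℝ) * Real.log (v.1.abv ((D.η l : kˣ) : k))).submatrix e e := by
    ext l n
    rw [Matrix.of_apply, Module.Basis.reindex_apply, Equiv.symm_symm, hb]
    rfl
  rw [h2, h3, Matrix.det_submatrix_equiv_self] at h1
  exact h1

lemma abs_det_eq_sRegulator {S : Finset (Place k)} {N : ℕ} (hN : S.card = N + 1)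
    (hS : ∀ v : Place k, v.IsArchimedean → v ∈ S) (u : Fin N → sUnits S)
    (B : Module.Basis (Fin N) ℤ (Additive (sUnits S ⧸ CommGroup.torsion (sUnits S))))
    (hB : ∀ l, B l = Additive.ofMul (QuotientGroup.mk (u l))) :
    ∃ c : Fin N → S, Function.Injective c ∧
      |(Matrix.of fun l n => ((c n).1.localDegree : ℝ) *
        Real.log ((c n).1.abv ((u l : kˣ) : k))).det| = sRegulator S := by
  have h := nonempty_regulatorData hS (Finset.card_pos.1 (by omega))
  rw [sRegulator, dif_pos h]
  exact abs_det_eq_of_regulatorData hN u B hB h.some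

end

/-- The group `𝔘_S(k)` is finitely generated of rank `s - 1`, and its height is
`s! Reg_S(k) / (2 [k : ℚ]) ^ (s - 1)`. -/
theorem theorem2 (k : Type*) [Field k] [NumberField k] [Algebra k Qbar]
    (S : Finset (Place k)) (hS : ∀ v : Place k, v.IsArchimedean → v ∈ S)
    (s : ℕ) (hs : S.card = s) (hs2 : 2 ≤ s) :
    (sUnitsImage S).FG ∧
    Module.finrank ℤ (Additive (sUnitsImage S)) = s - 1 ∧
    height (sUnitsImage S) =
      (s ! : ℝ) * sRegulator S / (2 * (Module.finrank ℚ k : ℝ)) ^ (s - 1) := by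
  let e : Additive (sUnits S ⧸ CommGroup.torsion (sUnits S)) ≃ₗ[ℤ] Additive (sUnitsImage S) :=
    (MulEquiv.toAdditive (sUnitsModTorsionEquiv S)).toIntLinearEquiv
  have hfin := finite_sUnits_quotient hS
  have hfin' : Module.Finite ℤ (Additive (sUnitsImage S)) := Module.Finite.equiv e
  have hfree' : Module.Free ℤ (Additive (sUnitsImage S)) := Module.Free.of_equiv e
  have hrank : Module.finrank ℤ (Additive (sUnitsImage S)) = s - 1 := by
    rw [← e.finrank_eq, finrank_sUnits_quotient hS, hs]
  refine ⟨?_, hrank, ?_⟩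
  · rw [← Group.fg_iff_subgroup_fg, GroupFG.iff_add_fg, ← Module.Finite.iff_addGroup_fg]
    exact hfin'
  have hbasis : Nonempty (Module.Basis (Fin (Module.finrank ℤ (Additive (sUnitsImage S)))) ℤ
      (Additive (sUnitsImage S))) := ⟨Module.finBasis ℤ _⟩
  rw [height, dif_pos hbasis]
  -- The computation works for every basis, so nothing about the chosen one is retained.
  generalize hbasis.some = b
  rw [← hrank]
  generalize Module.finrank ℤ (Additive (sUnitsImage S)) = N at b hrank ⊢
  -- Here s ≥ 2 excludes s = 0, where s - 1 is truncated.
  obtain rfl : s = N + 1 := by omega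
  let B := b.map e.symm
  choose u hu using fun l => QuotientGroup.mk_surjective (B l).toMul
  have hlog : ∀ y : Fin N → Place Qbar, deltaDet (fun l => logFun ((b l).toMul : GroupG)) y =
      (Matrix.of fun l n => Real.log (((y n).restrict k).abv ((u l : kˣ) : k))).det := by
    intro y
    rw [deltaDet]
    congr 2
    ext l n
    have h1 : b l = e (B l) := by simp [B]
    have h2 : ((b l).toMul : GroupG) = sUnitsToG S (u l) := by
      rw [h1, ← coe_sUnitsModTorsionEquiv_mk, hu]
      rfl
    rw [h2, logFun_sUnitsToG]
  simp_rw [hlog]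
  obtain ⟨c, hc, hreg⟩ := abs_det_eq_sRegulator hs hS u B fun l => by rw [hu]; rfl
  -- The product formula makes the row sums vanish; the minor given by c, known to be the regulator
  -- up to sign, serves as the reference minor.
  have hsum := sum_abs_det_submatrix (σ := S) (by simpa using hs)
    (Matrix.of fun l v => (v.1.localDegree : ℝ) * Real.log (v.1.abv ((u l : kˣ) : k)))
    (fun l => (Finset.sum_coe_sort S fun v => (v.localDegree : ℝ) *
      Real.log (v.abv ((u l : kˣ) : k))).trans (sum_localDegree_mul_log_sUnits (u l))) hc
  rw [integral_abs_det_log, show ∑ c : Fin N → S, |(Matrix.of fun l n =>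
    ((c n).1.localDegree : ℝ) * Real.log ((c n).1.abv ((u l : kˣ) : k))).det| =
      ((N + 1)! : ℝ) * sRegulator S from hsum.trans (congrArg _ hreg)]
  have hk : (Module.finrank ℚ k : ℝ) ≠ 0 := by
    exact_mod_cast (Module.finrank_pos (R := ℚ) (M := k)).ne'
  rw [mul_pow]
  field_simp
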